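/- For $p\ge r\ge 1$ let $\mathbb O_{p,r}=\{U\in\mathbb R^{p\times r}:U^\top U=I_r\}$, let $\lambda_k(M)$ denote the $k$-th largest singular value and $\|M\|$ the spectral norm of $M$, let $I(U)=\frac pr\max_{i}\|e_i^\top U\|_2^2$ be the incoherence constant of $U\in\mathbb O_{p,r}$, and for $U_1,U_2\in\mathbb O_{p,r}$ let $\|\sin\Theta(U_1,U_2)\|=\|U_{1\perp}^\top U_2\|=\|(I_p-U_1U_1^\top)U_2\|$, where $[U_1\ U_{1\perp}]$ is orthogonal. Given constants $c_I>0$ and $\kappa>1$ and numbers $\sigma_{\rm sum},\sigma_{\max},\nu>0$, let $\mathcal F_{p,n,r}(\sigma_{\rm sum},\sigma_{\max},\nu)$ be the class of matrices $\Sigma=U\Lambda U^\top+D$ such that $D$ is a non-negative diagonal $p\times p$ matrix with $\sum_i D_{ii}\le\sigma_{\rm sum}^2$ and $\max_i D_{ii}\le\sigma_{\max}^2$; $U\in\mathbb O_{p,r}$ with $I(U)\le c_I\,p/r$; and $\Lambda$ is a non-negative diagonal $r\times r$ matrix with $\|\Lambda\|/\lambda_r(\Lambda)\le\kappa$ and $\lambda_r(\Lambda)\ge\nu$.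 The elements $\Sigma$ are considered together with such a decomposition, so that $U$ is the parameter to be estimated. **Theorem (Heteroskedastic PCA: lower bound).** For every $c_I>0$ there is a constant $C>0$ depending only on $c_I$, and for every $\kappa>1$ a constant $c>0$ depending only on $c_I$ and $\kappa$, such that for all integers $n,r\ge1$ and $p\ge Cr$ and all real $\sigma_{\rm sum},\sigma_{\max},\nu$ with $\sqrt p\,\sigma_{\max}\ge\sigma_{\rm sum}\ge\sigma_{\max}>0$ and $\nu>0$, $$\inf_{\hat U}\ \sup_{\Sigma\in\mathcal F_{p,n,r}(\sigma_{\rm sum},\sigma_{\max},\nu)}\mathbb E\|\sin\Theta(\hat U,U)\|\ \ge\ c\left\{\frac1{\sqrt n}\left(\frac{\sigma_{\rm sum}+r^{1/2}\sigma_{\max}}{\nu^{1/2}}+\frac{\sigma_{\rm sum}\sigma_{\max}}{\nu}\right)\wedge1\right\},$$ where the expectation is over an i.i.d. sample $Y_1,\dots,Y_n\sim N(0,\Sigma)$ and the infimum is over all measurable $\hat U=\hat U(Y_1,\dots,Y_n)$ with values in $\mathbb O_{p,r}$. -/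

import Mathlib

open MeasureTheory ProbabilityTheory
open scoped Matrix Matrix.Norms.L2Operator ENNReal

noncomputable section

namespace HeteroPCA

/-- `OrthonormalCols U` says `U ∈ 𝕆_{p,r}`, i.e. `Uᵀ U = I_r`. -/
def OrthonormalCols {p r : ℕ} (U : Matrix (Fin p) (Fin r) ℝ) : Prop :=
  Uᵀ * U = 1

/-- The `k`-th largest singular value `λ_k(M)`, for `1 ≤ k`.
(Mathlib numbers the singular values from `0`.) -/
def singularValue {m n : ℕ} (M : Matrix (Fin m) (Fin n) ℝ) (k : ℕ) : ℝ :=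
  (Matrix.toEuclideanLin M).singularValues (k - 1)

/-- The incoherence constant `I(U) = (p / r) * max_i ‖e_iᵀ U‖₂²`. -/
def incoherence {p r : ℕ} (U : Matrix (Fin p) (Fin r) ℝ) : ℝ :=
  (p : ℝ) / r * ⨆ i : Fin p, ∑ j : Fin r, U i j ^ 2

/-- The spectral `sin Θ` distance between the column spaces of `U₁, U₂ ∈ 𝕆_{p,r}`, written with the
orthogonal projection `I - U₁ U₁ᵀ` onto the orthogonal complement of the column space of `U₁`; the
norm is the spectral norm. See `sinTheta_eq` for the form `‖U₁⊥ᵀ U₂‖`. -/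
def sinTheta {p r : ℕ} (U₁ U₂ : Matrix (Fin p) (Fin r) ℝ) : ℝ :=
  ‖(1 - U₁ * U₁ᵀ) * U₂‖

/-- If `[U₁ V]` is an orthogonal matrix, then `‖sin Θ(U₁, U₂)‖ = ‖Vᵀ U₂‖`. -/
theorem sinTheta_eq {p r s : ℕ} (U₁ U₂ : Matrix (Fin p) (Fin r) ℝ) (V : Matrix (Fin p) (Fin s) ℝ)
    (hV : Vᵀ * V = 1) (hUV : U₁ * U₁ᵀ + V * Vᵀ = 1) :
    sinTheta U₁ U₂ = ‖Vᵀ * U₂‖ := by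
  have h1 : (1 - U₁ * U₁ᵀ) * U₂ = V * (Vᵀ * U₂) := by
    rw [← hUV, add_sub_cancel_left, Matrix.mul_assoc]
  have h2 : (V * (Vᵀ * U₂))ᴴ * (V * (Vᵀ * U₂)) = (Vᵀ * U₂)ᴴ * (Vᵀ * U₂) := by
    simp only [Matrix.conjTranspose_eq_transpose_of_trivial, Matrix.transpose_mul,
      Matrix.transpose_transpose, Matrix.mul_assoc]
    rw [← Matrix.mul_assoc Vᵀ V, hV, Matrix.one_mul]
  have h3 := Matrix.l2_opNorm_conjTranspose_mul_self (V * (Vᵀ * U₂))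
  rw [h2, Matrix.l2_opNorm_conjTranspose_mul_self] at h3
  rw [sinTheta, h1]
  exact ((mul_self_inj (norm_nonneg _) (norm_nonneg _)).1 h3).symm

/-- Parameters of a generalized spiked covariance matrix `Σ = U Λ Uᵀ + D`. -/
structure Params (p r : ℕ) where
  U : Matrix (Fin p) (Fin r) ℝ
  Lam : Matrix (Fin r) (Fin r) ℝ
  D : Matrix (Fin p) (Fin p) ℝ

/-- The covariance matrix `Σ = U Λ Uᵀ + D`. -/
def Params.cov {p r : ℕ} (θ : Params p r) : Matrix (Fin p) (Fin p) ℝ :=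
  θ.U * θ.Lam * θ.Uᵀ + θ.D

/-- The class `F_{p,n,r}(σ_sum, σ_max, ν)` of incoherent spiked-plus-diagonal covariance matrices
`Σ = U Λ Uᵀ + D`, with incoherence level `cI` and condition number bound `κ`. Its elements are
recorded together with their decomposition, so that `U`, the estimand, can be referred to.
The sample size `n` does not enter the constraints. -/
structure InClass (cI κ : ℝ) {p r : ℕ} (σsum σmax ν : ℝ) (θ : Params p r) : Prop where
  D_diag : θ.D.IsDiag
  D_nonneg : ∀ i, 0 ≤ θ.D i i
  D_sum : ∑ i, θ.D i i ≤ σsum ^ 2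
  D_max : ∀ i, θ.D i i ≤ σmax ^ 2
  U_orth : OrthonormalCols θ.U
  U_incoherent : incoherence θ.U ≤ cI * p / r
  Lam_diag : θ.Lam.IsDiag
  Lam_nonneg : ∀ j, 0 ≤ θ.Lam j j
  Lam_cond : ‖θ.Lam‖ / singularValue θ.Lam r ≤ κ
  Lam_lower : ν ≤ singularValue θ.Lam r

/-- The joint law of `n` i.i.d. observations from `N(0, S)` on `ℝ^p`. -/
def sampleLaw {p : ℕ} (n : ℕ) (S : Matrix (Fin p) (Fin p) ℝ) :
    Measure (Fin n → EuclideanSpace ℝ (Fin p)) :=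
  Measure.pi fun _ => multivariateGaussian 0 S

/-- Estimators `Û` of `U`: measurable functions of the sample with values in `𝕆_{p,r}`. -/
structure Estimator (p n r : ℕ) where
  toFun : (Fin n → EuclideanSpace ℝ (Fin p)) → Matrix (Fin p) (Fin r) ℝ
  measurable_toFun : ∀ i j, Measurable fun Y => toFun Y i j
  orth : ∀ Y, OrthonormalCols (toFun Y)

/-- The risk `E ‖sin Θ(Û, U)‖` for `Y₁, …, Yₙ` i.i.d. from `N(0, U Λ Uᵀ + D)`. -/
def risk {p n r : ℕ} (Uhat : Estimator p n r) (θ : Params p r) : ℝ≥0∞ :=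
  ∫⁻ Y, ENNReal.ofReal (sinTheta (Uhat.toFun Y) θ.U) ∂(sampleLaw n θ.cov)

/-- The minimax risk `inf_Û sup_{Σ ∈ F_{p,n,r}(σ_sum, σ_max, ν)} E ‖sin Θ(Û, U)‖`. -/
def minimaxRisk (cI κ : ℝ) (p n r : ℕ) (σsum σmax ν : ℝ) : ℝ≥0∞ :=
  ⨅ Uhat : Estimator p n r, ⨆ (θ : Params p r) (_ : InClass cI κ σsum σmax ν θ), risk Uhat θ

end HeteroPCA

end

namespace HeteroPCA

/-! ### Testing between two exponential densities -/

section TwoPoint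

variable {Ω : Type*} [MeasurableSpace Ω]

/-! The rate is, up to constants, the larger of two pieces, and each piece comes from Assouad's
lemma on a hypercube of covariances indexed by signs of size `δ`. If sinΘ² between two vertices is
at least `δ²` times their Hamming distance, and flipping one sign cannot be detected from `n`
observations, then the risk is at least of order `√m * δ` for `m` signs (`assouad`).

For the piece `√r σmax / √(nν)`, all noise sits on one coordinate. The loadings of that coordinate
on the `r` factors are `± δ`, with `δ² ≍ σmax² / (nν)` unless a class constraint stops it earlier
(`lower_bound_noisyRow`). For the piece `(σsum/√ν + σsum σmax/ν) / √n`, noise of variance `σ² ≍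
σmax²` is spread over `2m ≍ σsum²/σmax²` coordinates, which carry one spike with `m` entries `± δ`,
and `δ² ≍ σ²(σ² + ν) / (nν²)` unless capped by `1/m` (`lower_bound_spike`). The remaining columns of
the factor are disjoint blocks of length `b ≥ 1/cI`, which keeps every row short.

The covariances may be singular, so Lebesgue densities are not available. Instead, flipping one sign
only reverses the regression of one coordinate on a Gaussian vector common to both hypotheses.
Relative to the joint law of that vector and an independent noise variable, the hypotheses have
densities `exp(±g - b)`, so a second-moment estimate bounds the testing error
(`two_point_of_density`, `two_point_sampleLaw`).

Class membership is checked on a factor `A` with covariance `A Aᵀ + D`: normalizing the images of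
the eigenvectors of `Aᵀ A` gives `U` with the same column space (`exists_params`). Angles are
bounded below by testing a normal vector of one column space against a vector of the other
(`sq_dotProduct_le_sinTheta`). -/

theorem pi_withDensity {n : ℕ} (R : Measure Ω) [IsProbabilityMeasure R] {f : Ω → ℝ≥0∞}
    (hf : Measurable f) [SigmaFinite (R.withDensity f)] :
    Measure.pi (fun _ : Fin n => R.withDensity f) =
      (Measure.pi fun _ : Fin n => R).withDensity fun ω => ∏ i, f (ω i) := by
  refine Measure.pi_eq fun s hs => ?_
  have hX : iIndepFun (fun (i : Fin n) (ω : Fin n → Ω) => (s i).indicator f (ω i))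
      (Measure.pi fun _ : Fin n => R) :=
    iIndepFun_pi (X := fun i => (s i).indicator f) fun i => (hf.indicator (hs i)).aemeasurable
  have hXm : ∀ i, Measurable fun ω : Fin n → Ω => (s i).indicator f (ω i) := fun i =>
    (hf.indicator (hs i)).comp (measurable_pi_apply i)
  rw [withDensity_apply _ (MeasurableSet.univ_pi hs),
    ← lintegral_indicator (MeasurableSet.univ_pi hs)]
  have h1 : ∀ ω : Fin n → Ω, (Set.univ.pi s).indicator (fun ω => ∏ i, f (ω i)) ω =
      ∏ i, (s i).indicator f (ω i) := by
    intro ω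
    by_cases h : ω ∈ Set.univ.pi s
    · rw [Set.indicator_of_mem h]
      exact Finset.prod_congr rfl fun i _ =>
        (Set.indicator_of_mem (h i (Set.mem_univ i)) f).symm
    · rw [Set.indicator_of_notMem h]
      simp only [Set.mem_pi, Set.mem_univ, true_implies, not_forall] at h
      obtain ⟨i, hi⟩ := h
      exact (Finset.prod_eq_zero (Finset.mem_univ i) (Set.indicator_of_notMem hi f)).symm
  simp_rw [h1]
  rw [lintegral_prod_eq_prod_lintegral_of_indepFun _ _ hX hXm]
  refine Finset.prod_congr rfl fun i _ => ?_
  rw [withDensity_apply _ (hs i), ← lintegral_indicator (hs i),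
    ← (measurePreserving_eval (fun _ : Fin n => R) i).lintegral_comp (hf.indicator (hs i))]

/-- Combines `1 + u ≤ exp u` with `(t + 1/2)² ≥ 0`. The bound is even in `t`, so one function lies
below both densities. -/
theorem min_exp_lower (g b t : ℝ) (ht : t = g ∨ t = -g) : 3 / 4 - g ^ 2 - b ≤ Real.exp (t - b) := by
  have := Real.add_one_le_exp (t - b)
  have h2 : g ^ 2 = t ^ 2 := by rcases ht with h | h <;> simp [h]
  nlinarith [sq_nonneg (t + 1 / 2)]

theorem ofReal_integral_le_lintegral {μ : Measure Ω} {f : Ω → ℝ} (hf : Integrable f μ) :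
    ENNReal.ofReal (∫ ω, f ω ∂μ) ≤ ∫⁻ ω, ENNReal.ofReal (f ω) ∂μ := by
  have h := ofReal_integral_eq_lintegral_ofReal hf.pos_part
    (Filter.Eventually.of_forall fun ω => le_max_right (f ω) 0)
  calc ENNReal.ofReal (∫ ω, f ω ∂μ) ≤ ENNReal.ofReal (∫ ω, max (f ω) 0 ∂μ) :=
        ENNReal.ofReal_le_ofReal (integral_mono hf hf.pos_part fun ω => le_max_left _ _)
    _ = _ := h
    _ = _ := by simp

/-- Testing between the densities `exp (±g - b)` from `n` independent observations: the sum of the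
two error probabilities is bounded below when `g` and `b` are small in mean. -/
theorem two_point_of_density {n : ℕ} (μ : Measure Ω) [IsProbabilityMeasure μ] {g b : Ω → ℝ} {q : ℝ}
    (hgm : Measurable g) (hbm : Measurable b) (hg : MemLp g 2 μ) (hb : Integrable b μ)
    (hg0 : ∫ ω, g ω ∂μ = 0) (hg2 : ∫ ω, g ω ^ 2 ∂μ ≤ q) (hb1 : ∫ ω, b ω ∂μ ≤ q / 2)
    (hq : n * q ≤ 1 / 4)
    [SigmaFinite (μ.withDensity fun ω => ENNReal.ofReal (Real.exp (g ω - b ω)))]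
    [SigmaFinite (μ.withDensity fun ω => ENNReal.ofReal (Real.exp (-g ω - b ω)))]
    {B : Set (Fin n → Ω)} (hB : MeasurableSet B) :
    ENNReal.ofReal (3 / 8) ≤
      Measure.pi (fun _ : Fin n => μ.withDensity fun ω => ENNReal.ofReal (Real.exp (g ω - b ω))) B +
      Measure.pi (fun _ : Fin n => μ.withDensity fun ω => ENNReal.ofReal (Real.exp (-g ω - b ω)))
        Bᶜ := by
  rw [pi_withDensity μ (by fun_prop), pi_withDensity μ (by fun_prop), withDensity_apply _ hB,
    withDensity_apply _ hB.compl]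
  set P := Measure.pi fun _ : Fin n => μ
  have hmp : ∀ i, MeasurePreserving (fun ω : Fin n → Ω => ω i) P μ := fun i =>
    measurePreserving_eval (fun _ : Fin n => μ) i
  let G : (Fin n → Ω) → ℝ := fun ω => ∑ i, g (ω i)
  let b' : (Fin n → Ω) → ℝ := fun ω => ∑ i, b (ω i)
  have hGL : MemLp G 2 P := memLp_finsetSum _ fun i _ => hg.comp_measurePreserving (hmp i)
  have hbI : Integrable b' P := integrable_finsetSum _ fun i _ => (hmp i).integrable_comp_of_integrable hb
  have hG0 : ∫ ω, G ω ∂P = 0 := by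
    change ∫ ω, ∑ i, (g ∘ fun ω : Fin n → Ω => ω i) ω ∂P = 0
    rw [integral_finsetSum _ fun i _ =>
      (hmp i).integrable_comp_of_integrable (hg.integrable (by norm_num))]
    refine Finset.sum_eq_zero fun i _ => ?_
    change ∫ ω : Fin n → Ω, g (ω i) ∂P = 0
    rw [integral_comp_eval (μ := fun _ : Fin n => μ) (i := i) hgm.aestronglyMeasurable, hg0]
  have hb'1 : ∫ ω, b' ω ∂P ≤ n * (q / 2) := by
    change ∫ ω, ∑ i, (b ∘ fun ω : Fin n → Ω => ω i) ω ∂P ≤ n * (q / 2)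
    rw [integral_finsetSum _ fun i _ => (hmp i).integrable_comp_of_integrable hb]
    have : ∀ i : Fin n, ∫ ω, b (ω i) ∂P ≤ q / 2 := fun i => by
      rw [integral_comp_eval (μ := fun _ : Fin n => μ) (i := i) hbm.aestronglyMeasurable]
      exact hb1
    exact (Finset.sum_le_sum fun i _ => this i).trans (by simp)
  -- Independence and centring make the second moment of the sum linear in `n`; without the zero
  -- mean it could grow like `n²`.
  have hG2 : ∫ ω, G ω ^ 2 ∂P ≤ n * q := by
    have h1 := variance_of_integral_eq_zero (X := G) (μ := P)
      (by fun_prop) hG0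
    have h2 : Var[G; P] = ∑ _i : Fin n, Var[g; μ] := by
      rw [← variance_sum_pi (μ := fun _ : Fin n => μ) (X := fun _ => g) fun _ => hg]
      congr 1
      ext ω
      simp [G]
    rw [← h1, h2, variance_of_integral_eq_zero hgm.aemeasurable hg0]
    exact (Finset.sum_le_sum fun i _ => hg2).trans (by simp)
  -- A common minorant of the two product densities. Its mean is at least `3/4 - nq - nq/2 ≥ 3/8`.
  let φ : (Fin n → Ω) → ℝ≥0∞ := fun ω => ENNReal.ofReal (3 / 4 - G ω ^ 2 - b' ω)
  have hφ : ENNReal.ofReal (3 / 8) ≤ ∫⁻ ω, φ ω ∂P := by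
    have hI : Integrable (fun ω => 3 / 4 - G ω ^ 2 - b' ω) P :=
      ((integrable_const _).sub hGL.integrable_sq).sub hbI
    refine le_trans (ENNReal.ofReal_le_ofReal ?_) (ofReal_integral_le_lintegral hI)
    have h1 := integral_sub ((integrable_const (3 / 4 : ℝ)).sub hGL.integrable_sq) hbI
    have h2 := integral_sub (integrable_const (3 / 4 : ℝ)) hGL.integrable_sq
    simp only [Pi.sub_apply] at h1
    rw [h1, h2]
    simp only [integral_const, probReal_univ, one_smul]
    linarith
  have key : ∀ (t : Ω → ℝ), (t = g ∨ t = fun ω => -g ω) → ∀ ω : Fin n → Ω,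
      φ ω ≤ ∏ i, ENNReal.ofReal (Real.exp (t (ω i) - b (ω i))) := by
    intro t ht ω
    rw [← ENNReal.ofReal_prod_of_nonneg fun i _ => (Real.exp_pos _).le, ← Real.exp_sum,
      Finset.sum_sub_distrib]
    refine ENNReal.ofReal_le_ofReal (min_exp_lower _ _ _ ?_)
    rcases ht with rfl | rfl
    · exact Or.inl rfl
    · exact Or.inr (by simp [G])
  calc ENNReal.ofReal (3 / 8) ≤ ∫⁻ ω, φ ω ∂P := hφ
    _ = ∫⁻ ω in B, φ ω ∂P + ∫⁻ ω in Bᶜ, φ ω ∂P := (lintegral_add_compl _ hB).symm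
    _ ≤ _ := add_le_add (lintegral_mono (key g (Or.inl rfl)))
        (lintegral_mono (key (fun ω => -g ω) (Or.inr rfl)))

end TwoPoint

/-! ### Gaussian laws that differ by the sign of a regression -/

section Gaussian

variable {p : ℕ}

theorem gaussianReal_shift_eq_withDensity (c : ℝ) {v : NNReal} (hv : v ≠ 0) :
    gaussianReal c v = (gaussianReal 0 v).withDensity
      fun y => ENNReal.ofReal (Real.exp (c * y / v - c ^ 2 / (2 * v))) := by
  have hv' : (v : ℝ) ≠ 0 := by exact_mod_cast hv
  rw [gaussianReal_of_var_ne_zero _ hv, gaussianReal_of_var_ne_zero _ hv,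
    ← withDensity_mul _ (measurable_gaussianPDF 0 v) (by fun_prop)]
  congr 1
  ext y
  simp only [Pi.mul_apply, gaussianPDF]
  rw [← ENNReal.ofReal_mul (gaussianPDFReal_nonneg _ _ _)]
  congr 1
  simp only [gaussianPDFReal]
  rw [mul_assoc _ (Real.exp _) (Real.exp _), ← Real.exp_add]
  congr 2
  field_simp
  ring

/-- The law of `(x, ⟨h, x⟩ + ε)` with `x ∼ μ` and `ε ∼ N(0, v)` independent has an exponential
density with respect to the law of `(x, ε)`. -/
theorem map_regression_eq_withDensity {E : Type*} [MeasurableSpace E] (μ : Measure E)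
    [IsProbabilityMeasure μ] {c : E → ℝ} (hc : Measurable c) {v : NNReal} (hv : v ≠ 0) :
    (μ.prod (gaussianReal 0 v)).map (fun z => (z.1, c z.1 + z.2)) =
      (μ.prod (gaussianReal 0 v)).withDensity
        fun z => ENNReal.ofReal (Real.exp (c z.1 * z.2 / v - c z.1 ^ 2 / (2 * v))) := by
  have hm : Measurable fun z : E × ℝ => (z.1, c z.1 + z.2) := by fun_prop
  ext s hs
  rw [Measure.map_apply hm hs, Measure.prod_apply (hm hs), withDensity_apply _ hs,
    ← lintegral_indicator hs, lintegral_prod _ (by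
      exact (Measurable.indicator (by fun_prop) hs).aemeasurable)]
  refine lintegral_congr fun x => ?_
  have h1 : gaussianReal 0 v (Prod.mk x ⁻¹' ((fun z : E × ℝ => (z.1, c z.1 + z.2)) ⁻¹' s)) =
      gaussianReal (c x) v (Prod.mk x ⁻¹' s) := by
    have := gaussianReal_map_const_add (μ := 0) (v := v) (c x)
    rw [zero_add] at this
    rw [← this, Measure.map_apply (by fun_prop) (measurable_prodMk_left hs)]
    rfl
  rw [h1, gaussianReal_shift_eq_withDensity _ hv, withDensity_apply _ (measurable_prodMk_left hs),
    ← lintegral_indicator (measurable_prodMk_left hs)]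
  rfl

/-- The hypothesis on quadratic forms is exactly equality of the two characteristic functions, so
neither covariance has to be invertible. -/
theorem multivariateGaussian_eq_map {S₀ S : Matrix (Fin p) (Fin p) ℝ} (hS₀ : S₀.PosSemidef)
    (hS : S.PosSemidef) (i : Fin p) (h : Fin p → ℝ) (v : NNReal)
    (hquad : ∀ t : Fin p → ℝ,
      t ⬝ᵥ S *ᵥ t = (t + t i • h) ⬝ᵥ S₀ *ᵥ (t + t i • h) + v * t i ^ 2) :
    multivariateGaussian 0 S =
      ((multivariateGaussian 0 S₀).prod (gaussianReal 0 v)).map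
        (fun z => z.1 + (inner ℝ (WithLp.toLp 2 h) z.1 + z.2) • EuclideanSpace.single i (1 : ℝ)) := by
  have hm : Measurable fun z : EuclideanSpace ℝ (Fin p) × ℝ =>
      z.1 + (inner ℝ (WithLp.toLp 2 h) z.1 + z.2) • EuclideanSpace.single i (1 : ℝ) :=
    Continuous.measurable (by fun_prop)
  have := Measure.isProbabilityMeasure_map (μ := (multivariateGaussian 0 S₀).prod (gaussianReal 0 v))
    hm.aemeasurable
  refine Measure.ext_of_charFun ?_
  ext t
  rw [charFun_multivariateGaussian hS, hquad, charFun_apply,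
    integral_map hm.aemeasurable (Measurable.aestronglyMeasurable (by fun_prop))]
  have h1 : ∀ z : EuclideanSpace ℝ (Fin p) × ℝ,
      Complex.exp (inner ℝ (z.1 + (inner ℝ (WithLp.toLp 2 h) z.1 + z.2) •
        EuclideanSpace.single i (1 : ℝ)) t * Complex.I) =
      Complex.exp (inner ℝ z.1 (t + t i • WithLp.toLp 2 h) * Complex.I) *
        Complex.exp (t i * z.2 * Complex.I) := by
    intro z
    rw [← Complex.exp_add, ← add_mul]
    congr 2
    rw [inner_add_left, inner_add_right, inner_smul_left, inner_smul_right,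
      EuclideanSpace.inner_single_left, real_inner_comm z.1]
    simp
    ring
  simp_rw [h1]
  rw [integral_prod_mul (fun x : EuclideanSpace ℝ (Fin p) =>
    Complex.exp (inner ℝ x (t + t i • WithLp.toLp 2 h) * Complex.I))
    (fun y : ℝ => Complex.exp (t i * y * Complex.I)), ← charFun_apply, ← charFun_apply_real,
    charFun_multivariateGaussian hS₀, charFun_gaussianReal, ← Complex.exp_add]
  congr 1
  simp
  ring

theorem memLp_inner_multivariateGaussian (S : Matrix (Fin p) (Fin p) ℝ)
    (h : EuclideanSpace ℝ (Fin p)) :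
    MemLp (fun x => inner ℝ h x) 2 (multivariateGaussian 0 S) :=
  IsGaussian.memLp_two_id.const_inner h

theorem integral_inner_multivariateGaussian (S : Matrix (Fin p) (Fin p) ℝ)
    (h : EuclideanSpace ℝ (Fin p)) :
    ∫ x, inner ℝ h x ∂(multivariateGaussian 0 S) = 0 := by
  have := (innerSL ℝ h).integral_comp_id_comm
    (IsGaussian.integrable_id (μ := multivariateGaussian 0 S))
  simpa using this

theorem integral_inner_sq_multivariateGaussian {S : Matrix (Fin p) (Fin p) ℝ} (hS : S.PosSemidef)
    (h : EuclideanSpace ℝ (Fin p)) :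
    ∫ x, (inner ℝ h x) ^ 2 ∂(multivariateGaussian 0 S) = h ⬝ᵥ S *ᵥ h := by
  rw [← covarianceBilin_multivariateGaussian (μ := 0) hS,
    covarianceBilin_self IsGaussian.memLp_two_id,
    variance_of_integral_eq_zero (Measurable.aemeasurable (by fun_prop))
      (integral_inner_multivariateGaussian S h)]

/-- Two covariance matrices `S₁`, `S₂` which only differ in the sign of the regression of the
`i`-th coordinate on the others cannot be told apart reliably from `n` observations. -/
theorem two_point_sampleLaw {n : ℕ} {S₀ S₁ S₂ : Matrix (Fin p) (Fin p) ℝ} (hS₀ : S₀.PosSemidef)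
    (hS₁ : S₁.PosSemidef) (hS₂ : S₂.PosSemidef) (i : Fin p) (h : Fin p → ℝ) {v : ℝ} (hv : 0 < v)
    (h₁ : ∀ t : Fin p → ℝ,
      t ⬝ᵥ S₁ *ᵥ t = (t + t i • h) ⬝ᵥ S₀ *ᵥ (t + t i • h) + v * t i ^ 2)
    (h₂ : ∀ t : Fin p → ℝ,
      t ⬝ᵥ S₂ *ᵥ t = (t - t i • h) ⬝ᵥ S₀ *ᵥ (t - t i • h) + v * t i ^ 2)
    (hn : n * (h ⬝ᵥ S₀ *ᵥ h) ≤ v / 4)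
    {B : Set (Fin n → EuclideanSpace ℝ (Fin p))} (hB : MeasurableSet B) :
    ENNReal.ofReal (3 / 8) ≤ sampleLaw n S₁ B + sampleLaw n S₂ Bᶜ := by
  lift v to NNReal using hv.le
  have hv0 : v ≠ 0 := by
    rintro rfl
    simp at hv
  -- Reference law of a pair `(x, ε)`. Replacing `ε` by `± ⟨h, x⟩ + ε` multiplies it by `exp(±g -
  -- b)`, and `T` then adds the second component to coordinate `i`.
  set R := (multivariateGaussian 0 S₀).prod (gaussianReal 0 v)
  let h' : EuclideanSpace ℝ (Fin p) := WithLp.toLp 2 h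
  let T : EuclideanSpace ℝ (Fin p) × ℝ → EuclideanSpace ℝ (Fin p) := fun z =>
    z.1 + z.2 • EuclideanSpace.single i (1 : ℝ)
  have hT : Measurable T := Continuous.measurable (by fun_prop)
  let g : EuclideanSpace ℝ (Fin p) × ℝ → ℝ := fun z => inner ℝ h' z.1 * z.2 / v
  let b : EuclideanSpace ℝ (Fin p) × ℝ → ℝ := fun z => (inner ℝ h' z.1) ^ 2 / (2 * v)
  have hm : ∀ c : EuclideanSpace ℝ (Fin p), Measurable fun x : EuclideanSpace ℝ (Fin p) =>
    inner ℝ c x := fun c => Continuous.measurable (by fun_prop)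
  have law : ∀ (S : Matrix (Fin p) (Fin p) ℝ) (k : Fin p → ℝ), S.PosSemidef →
      (∀ t : Fin p → ℝ,
        t ⬝ᵥ S *ᵥ t = (t + t i • k) ⬝ᵥ S₀ *ᵥ (t + t i • k) + v * t i ^ 2) →
      multivariateGaussian 0 S = (R.withDensity fun z => ENNReal.ofReal (Real.exp
        (inner ℝ (WithLp.toLp 2 k) z.1 * z.2 / v -
          inner ℝ (WithLp.toLp 2 k) z.1 ^ 2 / (2 * v)))).map T := by
    intro S k hS hk
    rw [multivariateGaussian_eq_map hS₀ hS i k v hk,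
      ← map_regression_eq_withDensity _ (hm (WithLp.toLp 2 k)) hv0, Measure.map_map hT
        (by have := hm (WithLp.toLp 2 k); fun_prop)]
    rfl
  have law₁ : multivariateGaussian 0 S₁ =
      (R.withDensity fun z => ENNReal.ofReal (Real.exp (g z - b z))).map T := law S₁ h hS₁ h₁
  have law₂ : multivariateGaussian 0 S₂ =
      (R.withDensity fun z => ENNReal.ofReal (Real.exp (-g z - b z))).map T := by
    rw [law S₂ (-h) hS₂ fun t => by simpa [sub_eq_add_neg] using h₂ t]
    congr 3
    ext z
    simp only [WithLp.toLp_neg, inner_neg_left, g, b, h']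
    congr 2
    ring
  have hgm : Measurable g := ((hm h').comp measurable_fst).mul measurable_snd |>.div_const _
  have hbm : Measurable b := ((hm h').comp measurable_fst).pow_const 2 |>.div_const _
  have hid : MemLp (fun y : ℝ => y) 2 (gaussianReal 0 v) := memLp_id_gaussianReal 2
  have hin := memLp_inner_multivariateGaussian S₀ h'
  have hgsq : (fun z => g z ^ 2) = fun z => (inner ℝ h' z.1) ^ 2 * (z.2 ^ 2 / v ^ 2) := by
    ext z
    simp only [g]
    ring
  have hy2 : ∫ y, y ^ 2 ∂(gaussianReal 0 v) = v := by
    rw [← variance_of_integral_eq_zero (X := fun y => y) (by fun_prop) (by simp)]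
    simp
  have hg : MemLp g 2 R := by
    rw [memLp_two_iff_integrable_sq hgm.aestronglyMeasurable, hgsq]
    exact hin.integrable_sq.mul_prod (hid.integrable_sq.div_const _)
  have hb : Integrable b R := (hin.integrable_sq.comp_fst _).div_const _
  have hg0 : ∫ z, g z ∂ R = 0 := by
    simp only [g]
    rw [integral_div, integral_prod_mul (fun x => inner ℝ h' x) fun y : ℝ => y]
    simp
  have hv2 : (v : ℝ) ≠ 0 := hv.ne'
  have hg2 : ∫ z, g z ^ 2 ∂ R ≤ (h ⬝ᵥ S₀ *ᵥ h) / v := by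
    rw [hgsq, integral_prod_mul (fun x => (inner ℝ h' x) ^ 2) fun y : ℝ => y ^ 2 / (v : ℝ) ^ 2,
      integral_div, hy2, integral_inner_sq_multivariateGaussian hS₀]
    apply le_of_eq
    simp only [h']
    field_simp
  have hb1 : ∫ z, b z ∂ R ≤ (h ⬝ᵥ S₀ *ᵥ h) / v / 2 := by
    simp only [b]
    rw [integral_div, integral_fun_fst fun x => (inner ℝ h' x) ^ 2,
      integral_inner_sq_multivariateGaussian hS₀]
    apply le_of_eq
    simp [h']
    field_simp
  -- Total mass one is read off from the image under `T`, which is a Gaussian law.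
  have hprob : ∀ (S : Matrix (Fin p) (Fin p) ℝ) (Q : Measure (EuclideanSpace ℝ (Fin p) × ℝ)),
      multivariateGaussian 0 S = Q.map T → IsProbabilityMeasure Q := fun S Q hSQ =>
    (Measure.isProbabilityMeasure_map_iff hT.aemeasurable).1 (hSQ ▸ inferInstance)
  have hp₁ := hprob _ _ law₁
  have hp₂ := hprob _ _ law₂
  have hTn : Measurable fun (ω : Fin n → EuclideanSpace ℝ (Fin p) × ℝ) k => T (ω k) := by fun_prop
  have main := two_point_of_density (n := n) R hgm hbm hg hb hg0 hg2 hb1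
    (by rw [mul_div_assoc', div_le_iff₀ hv]; linarith) (hTn hB)
  rw [sampleLaw, sampleLaw, law₁, law₂,
    ← Measure.pi_map_pi fun _ => hT.aemeasurable, ← Measure.pi_map_pi fun _ => hT.aemeasurable,
    Measure.map_apply hTn hB, Measure.map_apply hTn hB.compl]
  exact main

end Gaussian

/-! ### The sinΘ distance as a pseudometric -/

section SinTheta

variable {p r : ℕ}

theorem dotProduct_self_eq_norm_sq {m : ℕ} (x : Fin m → ℝ) : x ⬝ᵥ x = ‖WithLp.toLp 2 x‖ ^ 2 := by
  rw [EuclideanSpace.real_norm_sq_eq]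
  simp [dotProduct, sq]

theorem dotProduct_self_nonneg' {m : ℕ} (x : Fin m → ℝ) : 0 ≤ x ⬝ᵥ x :=
  Finset.sum_nonneg fun i _ => mul_self_nonneg (x i)

theorem dotProduct_sq_le {m : ℕ} (x y : Fin m → ℝ) : (x ⬝ᵥ y) ^ 2 ≤ (x ⬝ᵥ x) * (y ⬝ᵥ y) := by
  simpa [dotProduct, sq] using Finset.sum_mul_sq_le_sq_mul_sq Finset.univ x y

theorem mulVec_dotProduct_self_le {m k : ℕ} (M : Matrix (Fin m) (Fin k) ℝ) (x : Fin k → ℝ) :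
    (M *ᵥ x) ⬝ᵥ (M *ᵥ x) ≤ ‖M‖ ^ 2 * (x ⬝ᵥ x) := by
  rw [dotProduct_self_eq_norm_sq, dotProduct_self_eq_norm_sq, ← mul_pow]
  exact pow_le_pow_left₀ (norm_nonneg _) (Matrix.l2_opNorm_mulVec M (WithLp.toLp 2 x)) 2

theorem l2_opNorm_le_of_forall {m k : ℕ} {M : Matrix (Fin m) (Fin k) ℝ} {c : ℝ} (hc : 0 ≤ c)
    (h : ∀ x, (M *ᵥ x) ⬝ᵥ (M *ᵥ x) ≤ c ^ 2 * (x ⬝ᵥ x)) : ‖M‖ ≤ c := by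
  rw [Matrix.l2_opNorm_def]
  refine ContinuousLinearMap.opNorm_le_bound _ hc fun x => ?_
  have := h x
  rw [dotProduct_self_eq_norm_sq, dotProduct_self_eq_norm_sq, ← mul_pow] at this
  exact (sq_le_sq₀ (by positivity) (by positivity)).1 this

theorem dotProduct_mulVec_comm {m k : ℕ} (M : Matrix (Fin m) (Fin k) ℝ) (x : Fin k → ℝ)
    (y : Fin m → ℝ) : y ⬝ᵥ (M *ᵥ x) = (Mᵀ *ᵥ y) ⬝ᵥ x := by
  rw [Matrix.dotProduct_mulVec, Matrix.mulVec_transpose]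

theorem OrthonormalCols.mulVec_dotProduct {U : Matrix (Fin p) (Fin r) ℝ} (hU : OrthonormalCols U)
    (x y : Fin r → ℝ) : (U *ᵥ x) ⬝ᵥ (U *ᵥ y) = x ⬝ᵥ y := by
  rw [dotProduct_mulVec_comm, Matrix.mulVec_mulVec, hU, Matrix.one_mulVec]

theorem OrthonormalCols.proj_dotProduct {U : Matrix (Fin p) (Fin r) ℝ} (hU : OrthonormalCols U)
    (x : Fin p → ℝ) : ((1 - U * Uᵀ) *ᵥ x) ⬝ᵥ ((1 - U * Uᵀ) *ᵥ x) =
      x ⬝ᵥ x - (Uᵀ *ᵥ x) ⬝ᵥ (Uᵀ *ᵥ x) := by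
  have h : (1 - U * Uᵀ) *ᵥ x = x - U *ᵥ (Uᵀ *ᵥ x) := by
    rw [Matrix.sub_mulVec, Matrix.one_mulVec, Matrix.mulVec_mulVec]
  rw [h, sub_dotProduct, dotProduct_sub, dotProduct_sub, hU.mulVec_dotProduct,
    dotProduct_comm (U *ᵥ _) x, dotProduct_mulVec_comm]
  ring

theorem sinTheta_nonneg (U₁ U₂ : Matrix (Fin p) (Fin r) ℝ) : 0 ≤ sinTheta U₁ U₂ := norm_nonneg _

theorem sinTheta_le_of_forall {U₁ U₂ : Matrix (Fin p) (Fin r) ℝ} (h₁ : OrthonormalCols U₁)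
    (h₂ : OrthonormalCols U₂) {c : ℝ} (hc : 0 ≤ c) (h : ∀ x : Fin r → ℝ,
      x ⬝ᵥ x - ((U₁ᵀ * U₂) *ᵥ x) ⬝ᵥ ((U₁ᵀ * U₂) *ᵥ x) ≤ c ^ 2 * (x ⬝ᵥ x)) :
    sinTheta U₁ U₂ ≤ c := by
  refine l2_opNorm_le_of_forall hc fun x => ?_
  rw [← Matrix.mulVec_mulVec, h₁.proj_dotProduct, h₂.mulVec_dotProduct, Matrix.mulVec_mulVec]
  exact h x

theorem le_sinTheta_sq {U₁ U₂ : Matrix (Fin p) (Fin r) ℝ} (h₁ : OrthonormalCols U₁)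
    (h₂ : OrthonormalCols U₂) (x : Fin r → ℝ) :
    x ⬝ᵥ x - ((U₁ᵀ * U₂) *ᵥ x) ⬝ᵥ ((U₁ᵀ * U₂) *ᵥ x) ≤ sinTheta U₁ U₂ ^ 2 * (x ⬝ᵥ x) := by
  have := mulVec_dotProduct_self_le ((1 - U₁ * U₁ᵀ) * U₂) x
  rwa [← Matrix.mulVec_mulVec, h₁.proj_dotProduct, h₂.mulVec_dotProduct,
    Matrix.mulVec_mulVec] at this

/-- The square matrix `C = U₁ᵀ U₂` and its transpose have the same smallest singular value. If `ε <
1` then `C` is bijective, so `y = C x` with `(1 - ε²)|x|² ≤ |y|²`, and Cauchy–Schwarz in `|y|² = ⟨x,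
Cᵀ y⟩` transfers the lower bound to `Cᵀ`. -/
theorem sinTheta_comm_le {U₁ U₂ : Matrix (Fin p) (Fin r) ℝ} (h₁ : OrthonormalCols U₁)
    (h₂ : OrthonormalCols U₂) : sinTheta U₂ U₁ ≤ sinTheta U₁ U₂ := by
  refine sinTheta_le_of_forall h₂ h₁ (sinTheta_nonneg _ _) fun y => ?_
  set ε := sinTheta U₁ U₂
  set C := U₁ᵀ * U₂
  have hC : U₂ᵀ * U₁ = Cᵀ := by rw [Matrix.transpose_mul, Matrix.transpose_transpose]
  rw [hC]
  have hz := dotProduct_self_nonneg' (Cᵀ *ᵥ y)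
  have hy := dotProduct_self_nonneg' y
  rcases le_or_gt 1 ε with hε | hε
  · nlinarith [mul_le_mul_of_nonneg_right (show 1 ≤ ε ^ 2 by nlinarith) hy]
  have hε0 : 0 ≤ ε := sinTheta_nonneg _ _
  have hε2 : 0 < 1 - ε ^ 2 := by nlinarith
  have hlow : ∀ x, (1 - ε ^ 2) * (x ⬝ᵥ x) ≤ (C *ᵥ x) ⬝ᵥ (C *ᵥ x) := fun x => by
    have := le_sinTheta_sq h₁ h₂ x
    linarith
  have hinj : Function.Injective C.mulVec := by
    rw [← Matrix.coe_mulVecLin, injective_iff_map_eq_zero]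
    intro x hx
    rw [Matrix.mulVecLin_apply] at hx
    have h := hlow x
    rw [hx, zero_dotProduct] at h
    exact dotProduct_self_eq_zero.1 (le_antisymm (by nlinarith) (dotProduct_self_nonneg' x))
  have hsurj : Function.Surjective C.mulVec := by
    rw [← Matrix.coe_mulVecLin] at hinj ⊢
    exact LinearMap.injective_iff_surjective.1 hinj
  obtain ⟨x, rfl⟩ := hsurj y
  have h3 := hlow x
  have h4 := dotProduct_sq_le x (Cᵀ *ᵥ (C *ᵥ x))
  rw [dotProduct_comm x, ← dotProduct_mulVec_comm] at h4
  rcases hy.eq_or_lt with h0 | h0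
  · nlinarith
  have h5 : (1 - ε ^ 2) * ((C *ᵥ x) ⬝ᵥ (C *ᵥ x)) ≤ (Cᵀ *ᵥ (C *ᵥ x)) ⬝ᵥ (Cᵀ *ᵥ (C *ᵥ x)) := by
    refine le_of_mul_le_mul_left ?_ h0
    nlinarith [mul_le_mul_of_nonneg_right h3 hz]
  linarith

theorem sinTheta_comm {U₁ U₂ : Matrix (Fin p) (Fin r) ℝ} (h₁ : OrthonormalCols U₁)
    (h₂ : OrthonormalCols U₂) : sinTheta U₁ U₂ = sinTheta U₂ U₁ :=
  le_antisymm (sinTheta_comm_le h₂ h₁) (sinTheta_comm_le h₁ h₂)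

theorem OrthonormalCols.norm_le_one {U : Matrix (Fin p) (Fin r) ℝ} (hU : OrthonormalCols U) :
    ‖U‖ ≤ 1 :=
  l2_opNorm_le_of_forall zero_le_one fun x => by rw [hU.mulVec_dotProduct]; simp

theorem OrthonormalCols.norm_transpose_le_one {U : Matrix (Fin p) (Fin r) ℝ}
    (hU : OrthonormalCols U) : ‖Uᵀ‖ ≤ 1 := by
  rw [← Matrix.conjTranspose_eq_transpose_of_trivial, Matrix.l2_opNorm_conjTranspose]
  exact hU.norm_le_one

theorem OrthonormalCols.norm_proj_le_one {U : Matrix (Fin p) (Fin r) ℝ} (hU : OrthonormalCols U) :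
    ‖1 - U * Uᵀ‖ ≤ 1 :=
  l2_opNorm_le_of_forall zero_le_one fun x => by
    rw [hU.proj_dotProduct]
    linarith [dotProduct_self_nonneg' (Uᵀ *ᵥ x)]

/-- Insert `1 = U₂ U₂ᵀ + (1 - U₂ U₂ᵀ)` in front of `U₃`; all the extra factors are contractions. -/
theorem sinTheta_triangle {U₁ U₂ U₃ : Matrix (Fin p) (Fin r) ℝ} (h₁ : OrthonormalCols U₁)
    (h₂ : OrthonormalCols U₂) (h₃ : OrthonormalCols U₃) :
    sinTheta U₁ U₃ ≤ sinTheta U₁ U₂ + sinTheta U₂ U₃ := by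
  have h : (1 - U₁ * U₁ᵀ) * U₃ =
      (1 - U₁ * U₁ᵀ) * U₂ * (U₂ᵀ * U₃) + (1 - U₁ * U₁ᵀ) * ((1 - U₂ * U₂ᵀ) * U₃) := by
    rw [Matrix.mul_assoc, ← Matrix.mul_add, ← Matrix.mul_assoc U₂, ← Matrix.add_mul,
      add_sub_cancel, Matrix.one_mul]
  have h4 : ‖U₂ᵀ * U₃‖ ≤ 1 := (Matrix.l2_opNorm_mul _ _).trans
    (mul_le_one₀ h₂.norm_transpose_le_one (norm_nonneg _) h₃.norm_le_one)
  calc sinTheta U₁ U₃ ≤ ‖(1 - U₁ * U₁ᵀ) * U₂ * (U₂ᵀ * U₃)‖ +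
        ‖(1 - U₁ * U₁ᵀ) * ((1 - U₂ * U₂ᵀ) * U₃)‖ := by
        rw [sinTheta, h]
        exact norm_add_le _ _
    _ ≤ _ := add_le_add
        ((Matrix.l2_opNorm_mul _ _).trans (mul_le_of_le_one_right (norm_nonneg _) h4))
        ((Matrix.l2_opNorm_mul _ _).trans (mul_le_of_le_one_left (norm_nonneg _) h₁.norm_proj_le_one))

theorem measurable_sinTheta {Ω : Type*} [MeasurableSpace Ω] {V : Ω → Matrix (Fin p) (Fin r) ℝ}
    (hV : ∀ i j, Measurable fun ω => V ω i j) (U : Matrix (Fin p) (Fin r) ℝ) :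
    Measurable fun ω => sinTheta (V ω) U := by
  have hc : Continuous fun W : Fin p → Fin r → ℝ =>
      sinTheta (Matrix.of W) U := by
    have h0 : Continuous fun W : Fin p → Fin r → ℝ => (Matrix.of W : Matrix (Fin p) (Fin r) ℝ) :=
      continuous_id
    unfold sinTheta
    exact (((continuous_const.sub (h0.matrix_mul h0.matrix_transpose)).matrix_mul
      continuous_const).norm)
  exact hc.measurable.comp (measurable_pi_iff.2 fun i => measurable_pi_iff.2 fun j => hV i j)

end SinTheta

/-! ### Assouad's lemma -/

section Assouad

/-- Used to round an estimator to a nearest vertex of the hypercube while keeping measurability. -/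
theorem exists_measurable_argmin {Ω ι : Type*} [MeasurableSpace Ω] [Fintype ι] [Nonempty ι]
    [MeasurableSpace ι] [DiscreteMeasurableSpace ι] {F : ι → Ω → ℝ} (hF : ∀ i, Measurable (F i)) :
    ∃ f : Ω → ι, Measurable f ∧ ∀ ω i, F (f ω) ω ≤ F i ω := by
  classical
  suffices h : ∀ S : Finset ι, ∃ f : Ω → ι, Measurable f ∧ ∀ ω, ∀ i ∈ S, F (f ω) ω ≤ F i ω by
    obtain ⟨f, hf, h⟩ := h Finset.univ
    exact ⟨f, hf, fun ω i => h ω i (Finset.mem_univ i)⟩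
  intro S
  induction S using Finset.induction_on with
  | empty => exact ⟨fun _ => Classical.arbitrary ι, measurable_const, by simp⟩
  | insert a S _ ih =>
    obtain ⟨f, hf, h⟩ := ih
    have hFf : Measurable fun ω => F (f ω) ω :=
      (measurable_from_prod_countable_right (f := fun z : ι × Ω => F z.1 z.2) hF).comp
        (hf.prodMk measurable_id)
    have hset : MeasurableSet {ω | F a ω < F (f ω) ω} := measurableSet_lt (hF a) hFf
    refine ⟨fun ω => if F a ω < F (f ω) ω then a else f ω,
      Measurable.ite hset measurable_const hf, fun ω i hi => ?_⟩
    rw [Finset.mem_insert] at hi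
    by_cases hlt : F a ω < F (f ω) ω
    · simp only [hlt, if_true]
      rcases hi with rfl | hi
      · exact le_rfl
      · exact hlt.le.trans (h ω i hi)
    · simp only [hlt, if_false]
      rcases hi with rfl | hi
      · exact not_lt.1 hlt
      · exact h ω i hi

/-- Change the `k`-th sign. -/
def flip {m : ℕ} (k : Fin m) (s : Fin m → Bool) : Fin m → Bool := Function.update s k (!s k)

theorem flip_involutive {m : ℕ} (k : Fin m) : Function.Involutive (flip k) := fun s => by
  simp [flip]

/-- Assouad's lemma for the risk of subspace estimators. -/
theorem assouad {p n r m : ℕ} (hm : 0 < m) {cI κ σsum σmax ν δ : ℝ}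
    (θ : (Fin m → Bool) → Params p r) (hθ : ∀ s, InClass cI κ σsum σmax ν (θ s)) (hδ : 0 ≤ δ)
    (hsep : ∀ s s', δ ^ 2 * (Finset.univ.filter fun k => s k ≠ s' k).card ≤
      sinTheta (θ s).U (θ s').U ^ 2)
    (htest : ∀ s k, ∀ B : Set (Fin n → EuclideanSpace ℝ (Fin p)), MeasurableSet B →
      ENNReal.ofReal (3 / 8) ≤
        sampleLaw n (θ s).cov B + sampleLaw n (θ (flip k s)).cov Bᶜ) :
    ENNReal.ofReal (3 / 32 * (√m * δ)) ≤ minimaxRisk cI κ p n r σsum σmax ν := by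
  refine le_iInf fun Uhat => ?_
  set M := ⨆ (θ : Params p r) (_ : InClass cI κ σsum σmax ν θ), risk Uhat θ
  obtain ⟨f, hf, hmin⟩ := exists_measurable_argmin fun s : Fin m → Bool =>
    measurable_sinTheta Uhat.measurable_toFun (θ s).U
  -- The price of one wrong sign. With `H ≤ m` wrong signs the distance `δ√H` is at least `δH/√m`,
  -- which is additive over the coordinates; the factor 2 pays for rounding the estimator.
  let c : ℝ := δ / (2 * √m)
  have hm' : (0 : ℝ) < √m := Real.sqrt_pos.2 (by exact_mod_cast hm)
  let A : (Fin m → Bool) → Fin m → Set (Fin n → EuclideanSpace ℝ (Fin p)) := fun s k =>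
    {Y | f Y k ≠ s k}
  have hA : ∀ s k, MeasurableSet (A s k) := fun s k =>
    hf (MeasurableSet.of_discrete (s := {t : Fin m → Bool | t k ≠ s k}))
  have hpt : ∀ s Y, ∑ k, (A s k).indicator (fun _ => ENNReal.ofReal c) Y ≤
      ENNReal.ofReal (sinTheta (Uhat.toFun Y) (θ s).U) := by
    intro s Y
    set H := Finset.univ.filter fun k => f Y k ≠ s k
    have h1 : ∑ k, (A s k).indicator (fun _ => ENNReal.ofReal c) Y =
        ENNReal.ofReal (H.card * c) := by
      rw [ENNReal.ofReal_mul (by positivity), ENNReal.ofReal_natCast, ← nsmul_eq_mul,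
        ← Finset.sum_const, Finset.sum_filter]
      exact Finset.sum_congr rfl fun k _ => by simp [A, Set.indicator_apply]
    rw [h1]
    refine ENNReal.ofReal_le_ofReal ?_
    have h2 : sinTheta (θ (f Y)).U (θ s).U ≤ 2 * sinTheta (Uhat.toFun Y) (θ s).U := by
      have := sinTheta_triangle (hθ (f Y)).U_orth (Uhat.orth Y) (hθ s).U_orth
      rw [sinTheta_comm (hθ (f Y)).U_orth (Uhat.orth Y)] at this
      linarith [hmin Y s]
    have h3 : δ * √H.card ≤ sinTheta (θ (f Y)).U (θ s).U := by
      refine (sq_le_sq₀ (by positivity) (sinTheta_nonneg _ _)).1 ?_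
      rw [mul_pow, Real.sq_sqrt (by positivity)]
      exact hsep (f Y) s
    have h4 : (H.card : ℝ) ≤ √m * √H.card := by
      have : H.card ≤ m := (Finset.card_le_univ _).trans (by simp)
      calc (H.card : ℝ) = √H.card * √H.card := (Real.mul_self_sqrt (by positivity)).symm
        _ ≤ _ := by gcongr
    have h5 : (H.card : ℝ) * c ≤ δ * √H.card / 2 := by
      simp only [c]
      rw [mul_div_assoc', div_le_div_iff₀ (by positivity) (by positivity)]
      nlinarith [mul_le_mul_of_nonneg_left h4 hδ]
    linarith
  have hrisk : ∀ s, ENNReal.ofReal c * ∑ k, sampleLaw n (θ s).cov (A s k) ≤ M := by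
    intro s
    calc ENNReal.ofReal c * ∑ k, sampleLaw n (θ s).cov (A s k)
        = ∫⁻ Y, ∑ k, (A s k).indicator (fun _ => ENNReal.ofReal c) Y ∂(sampleLaw n (θ s).cov) := by
          rw [lintegral_finsetSum _ fun k _ => measurable_const.indicator (hA s k), Finset.mul_sum]
          exact Finset.sum_congr rfl fun k _ => (lintegral_indicator_const (hA s k) _).symm
      _ ≤ risk Uhat (θ s) := lintegral_mono (hpt s)
      _ ≤ M := le_iSup₂ (f := fun (θ : Params p r) (_ : InClass cI κ σsum σmax ν θ) =>
          risk Uhat θ) (θ s) (hθ s)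
  have hcompl : ∀ s k, A (flip k s) k = (A s k)ᶜ := by
    intro s k
    ext Y
    simp [A, flip]
  -- Flipping the `k`-th sign permutes the cube and turns the event of guessing that sign wrongly
  -- into its complement, so averaging over vertices pairs the two test errors.
  have hsum : ∀ k, ∑ _s : Fin m → Bool, ENNReal.ofReal (3 / 8) ≤
      2 * ∑ s, sampleLaw n (θ s).cov (A s k) := by
    intro k
    have h1 : ∑ s, sampleLaw n (θ (flip k s)).cov (A (flip k s) k) =
        ∑ s, sampleLaw n (θ s).cov (A s k) :=
      Equiv.sum_comp (flip_involutive k).toPerm fun s => sampleLaw n (θ s).cov (A s k)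
    rw [two_mul]
    nth_rewrite 2 [← h1]
    rw [← Finset.sum_add_distrib]
    exact Finset.sum_le_sum fun s _ => by
      rw [hcompl]
      exact htest s k (A s k) (hA s k)
  set N : ℝ≥0∞ := (Fintype.card (Fin m → Bool) : ℝ≥0∞)
  have hN0 : N ≠ 0 := by simp [N]
  have hNt : N ≠ ∞ := by simp [N]
  have h2M : N * (m * (ENNReal.ofReal c * ENNReal.ofReal (3 / 8))) ≤ N * (2 * M) := by
    calc N * (m * (ENNReal.ofReal c * ENNReal.ofReal (3 / 8)))
        = ENNReal.ofReal c * ∑ _k : Fin m, ∑ _s : Fin m → Bool, ENNReal.ofReal (3 / 8) := by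
          simp only [Finset.sum_const, Finset.card_univ, nsmul_eq_mul, Fintype.card_fin, N]
          ring
      _ ≤ ENNReal.ofReal c * ∑ k : Fin m, 2 * ∑ s, sampleLaw n (θ s).cov (A s k) := by
          gcongr with k
          exact hsum k
      _ = 2 * ∑ s, ENNReal.ofReal c * ∑ k, sampleLaw n (θ s).cov (A s k) := by
          rw [← Finset.mul_sum, Finset.sum_comm, ← Finset.mul_sum]
          ring
      _ ≤ 2 * ∑ _s : Fin m → Bool, M := by
          gcongr with s
          exact hrisk s
      _ = N * (2 * M) := by
          simp only [Finset.sum_const, Finset.card_univ, nsmul_eq_mul, N]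
          ring
  rw [ENNReal.mul_le_mul_iff_right hN0 hNt] at h2M
  have h3 : (m : ℝ≥0∞) * (ENNReal.ofReal c * ENNReal.ofReal (3 / 8)) =
      2 * ENNReal.ofReal (3 / 32 * (√m * δ)) := by
    rw [← ENNReal.ofReal_mul (by positivity), ← ENNReal.ofReal_natCast m,
      ← ENNReal.ofReal_mul (by positivity), ← ENNReal.ofReal_ofNat 2,
      ← ENNReal.ofReal_mul (by norm_num)]
    congr 1
    have hsq : √(m : ℝ) * √m = m := Real.mul_self_sqrt (by positivity)
    have hc : m * c = √m * δ / 2 := by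
      simp only [c]
      rw [mul_div_assoc', div_eq_div_iff (by positivity) (by positivity)]
      linear_combination (-2 * δ) * hsq
    linear_combination 3 / 8 * hc
  rw [h3, ENNReal.mul_le_mul_iff_right (by norm_num) (by norm_num)] at h2M
  exact h2M

end Assouad

/-! ### Elements of the class from a factor, and block columns -/

section Construction

variable {p r : ℕ}

theorem exists_orthogonal_diagonalization (G : Matrix (Fin r) (Fin r) ℝ) (hG : Gᵀ = G) :
    ∃ (Q : Matrix (Fin r) (Fin r) ℝ) (μ : Fin r → ℝ), Qᵀ * Q = 1 ∧ Q * Qᵀ = 1 ∧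
      Qᵀ * G * Q = Matrix.diagonal μ := by
  have hG' : G.IsHermitian := by
    rw [Matrix.IsHermitian, Matrix.conjTranspose_eq_transpose_of_trivial, hG]
  have hQ := hG'.eigenvectorUnitary.2
  rw [Matrix.mem_unitaryGroup_iff] at hQ
  have hQ' := hG'.eigenvectorUnitary.2
  rw [Matrix.mem_unitaryGroup_iff'] at hQ'
  have hs := hG'.spectral_theorem
  rw [Unitary.conjStarAlgAut_apply] at hs
  rw [Matrix.star_eq_conjTranspose, Matrix.conjTranspose_eq_transpose_of_trivial] at hQ hQ' hs
  refine ⟨hG'.eigenvectorUnitary, hG'.eigenvalues, hQ', hQ, ?_⟩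
  set Q := (hG'.eigenvectorUnitary : Matrix (Fin r) (Fin r) ℝ)
  set D := Matrix.diagonal hG'.eigenvalues
  calc Qᵀ * G * Q = Qᵀ * (Q * D * Qᵀ) * Q := congrArg (fun X => Qᵀ * X * Q) hs
    _ = Qᵀ * Q * D * (Qᵀ * Q) := by simp only [Matrix.mul_assoc]
    _ = D := by rw [hQ', Matrix.one_mul, Matrix.mul_one]

/-- The square of the last singular value is an eigenvalue of the adjoint composed with the map;
apply the hypothesis to its eigenvector. -/
theorem le_singularValue {M : Matrix (Fin r) (Fin r) ℝ} (hr : 1 ≤ r) {c : ℝ} (hc : 0 ≤ c)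
    (h : ∀ x, c ^ 2 * (x ⬝ᵥ x) ≤ (M *ᵥ x) ⬝ᵥ (M *ᵥ x)) : c ≤ singularValue M r := by
  set T := Matrix.toEuclideanLin M
  have hev := T.hasEigenvalue_adjoint_comp_self_sq_singularValues (n := r - 1)
    (by rw [finrank_euclideanSpace_fin]; omega)
  obtain ⟨x, hx⟩ := hev.exists_hasEigenvector
  have hx0 : x ≠ 0 := hx.2
  have hTx := hx.apply_eq_smul
  have h1 : ‖T x‖ ^ 2 = T.singularValues (r - 1) ^ 2 * ‖x‖ ^ 2 := by
    rw [← real_inner_self_eq_norm_sq, ← LinearMap.adjoint_inner_right, ← LinearMap.comp_apply, hTx,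
      inner_smul_right, real_inner_self_eq_norm_sq]
    rfl
  have h2 := h x.ofLp
  rw [dotProduct_self_eq_norm_sq, dotProduct_self_eq_norm_sq] at h2
  have h3 : c ^ 2 * ‖x‖ ^ 2 ≤ ‖T x‖ ^ 2 := h2
  rw [h1] at h3
  have h4 := le_of_mul_le_mul_right h3 (by positivity)
  exact (sq_le_sq₀ hc (T.singularValues_nonneg _)).1 h4

theorem incoherence_le {U : Matrix (Fin p) (Fin r) ℝ} {cI : ℝ} (hcI : 0 ≤ cI)
    (h : ∀ i, ∑ j, U i j ^ 2 ≤ cI) : incoherence U ≤ cI * p / r := by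
  have : (⨆ i : Fin p, ∑ j : Fin r, U i j ^ 2) ≤ cI := Real.iSup_le h hcI
  calc incoherence U ≤ (p : ℝ) / r * cI := by unfold incoherence; gcongr
    _ = _ := by ring

/-- Every factor `A` whose Gram matrix has spectrum in `[ν, κ ν]` and whose rows are short gives an
element of the class with covariance `A Aᵀ + D`. -/
theorem exists_params {cI κ σsum σmax ν : ℝ} (hr : 1 ≤ r) (hcI : 0 < cI) (hκ : 1 < κ) (hν : 0 < ν)
    (A : Matrix (Fin p) (Fin r) ℝ) (d : Fin p → ℝ) (hd0 : ∀ i, 0 ≤ d i)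
    (hdsum : ∑ i, d i ≤ σsum ^ 2) (hdmax : ∀ i, d i ≤ σmax ^ 2)
    (hlow : ∀ x, ν * (x ⬝ᵥ x) ≤ (A *ᵥ x) ⬝ᵥ (A *ᵥ x))
    (hup : ∀ x, (A *ᵥ x) ⬝ᵥ (A *ᵥ x) ≤ κ * ν * (x ⬝ᵥ x))
    (hrow : ∀ i, ∑ j, A i j ^ 2 ≤ ν * cI) :
    ∃ θ : Params p r, InClass cI κ σsum σmax ν θ ∧ θ.cov = A * Aᵀ + Matrix.diagonal d ∧
      (∃ M : Matrix (Fin r) (Fin r) ℝ, θ.U = A * M) ∧ ∃ N : Matrix (Fin r) (Fin r) ℝ, A = θ.U * N := by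
  obtain ⟨Q, μ, hQ1, hQ2, hQ3⟩ := exists_orthogonal_diagonalization (Aᵀ * A)
    (by rw [Matrix.transpose_mul, Matrix.transpose_transpose])
  have hμ : ∀ j, μ j = (A *ᵥ (Q *ᵥ Pi.single j 1)) ⬝ᵥ (A *ᵥ (Q *ᵥ Pi.single j 1)) := by
    intro j
    have : μ j = Pi.single j 1 ⬝ᵥ (Matrix.diagonal μ *ᵥ Pi.single j 1) := by
      simp
    rw [this, ← hQ3, dotProduct_mulVec_comm A, dotProduct_comm, dotProduct_comm _ (Q *ᵥ _),
      dotProduct_comm (Q *ᵥ _), dotProduct_mulVec_comm Q]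
    simp only [Matrix.mulVec_mulVec, Matrix.mul_assoc]
  have hunit : ∀ j, (Q *ᵥ Pi.single j 1) ⬝ᵥ (Q *ᵥ Pi.single j 1) = (1 : ℝ) := by
    intro j
    rw [OrthonormalCols.mulVec_dotProduct (U := Q) hQ1]
    simp
  have hμlow : ∀ j, ν ≤ μ j := fun j => by
    have := hlow (Q *ᵥ Pi.single j 1)
    rwa [hunit, mul_one, ← hμ] at this
  have hμup : ∀ j, μ j ≤ κ * ν := fun j => by
    have := hup (Q *ᵥ Pi.single j 1)
    rwa [hunit, mul_one, ← hμ] at this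
  have hμ0 : ∀ j, 0 < μ j := fun j => hν.trans_le (hμlow j)
  let w : Fin r → ℝ := fun j => (√(μ j))⁻¹
  have hw : ∀ j, w j * μ j * w j = 1 := fun j => by
    have h1 := Real.mul_self_sqrt (hμ0 j).le
    have h2 := Real.sqrt_pos.2 (hμ0 j)
    simp only [w]
    field_simp
    nlinarith
  -- The vectors `A q_j`, for `q_j` an orthonormal eigenbasis of `Aᵀ A`, are orthogonal with squared
  -- lengths `μ j`; `w` normalizes them.
  let U : Matrix (Fin p) (Fin r) ℝ := A * Q * Matrix.diagonal w
  have hUorth : OrthonormalCols U := by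
    have : Uᵀ * U = Matrix.diagonal w * (Qᵀ * (Aᵀ * A) * Q) * Matrix.diagonal w := by
      simp only [U, Matrix.transpose_mul, Matrix.diagonal_transpose, Matrix.mul_assoc]
    rw [OrthonormalCols, this, hQ3, Matrix.diagonal_mul_diagonal, Matrix.diagonal_mul_diagonal]
    simp [hw]
  have hΛ : U * Matrix.diagonal μ * Uᵀ = A * Aᵀ := by
    have : U * Matrix.diagonal μ * Uᵀ =
        A * Q * (Matrix.diagonal w * Matrix.diagonal μ * Matrix.diagonal w) * Qᵀ * Aᵀ := by
      simp only [U, Matrix.transpose_mul, Matrix.diagonal_transpose, Matrix.mul_assoc]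
    rw [this, Matrix.diagonal_mul_diagonal, Matrix.diagonal_mul_diagonal]
    simp only [hw, Matrix.diagonal_one, Matrix.mul_one]
    rw [Matrix.mul_assoc A Q, hQ2, Matrix.mul_one]
  have hAU : A = U * (Matrix.diagonal (fun j => √(μ j)) * Qᵀ) := by
    have : (Matrix.diagonal w : Matrix (Fin r) (Fin r) ℝ) * Matrix.diagonal (fun j => √(μ j)) = 1 := by
      rw [Matrix.diagonal_mul_diagonal, ← Matrix.diagonal_one]
      congr 1
      ext j
      exact inv_mul_cancel₀ (Real.sqrt_pos.2 (hμ0 j)).ne'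
    simp only [U]
    rw [Matrix.mul_assoc, ← Matrix.mul_assoc (Matrix.diagonal w), this, Matrix.one_mul,
      Matrix.mul_assoc, hQ2, Matrix.mul_one]
  have hrowU : ∀ i, ∑ j, U i j ^ 2 ≤ cI := by
    intro i
    have h1 : ∑ j, (A * Q) i j ^ 2 = ∑ j, A i j ^ 2 := by
      have e : ∀ B : Matrix (Fin p) (Fin r) ℝ, ∑ j, B i j ^ 2 = (B * Bᵀ) i i := fun B => by
        simp [Matrix.mul_apply, sq]
      rw [e, e, Matrix.transpose_mul, Matrix.mul_assoc, ← Matrix.mul_assoc Q, hQ2, Matrix.one_mul]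
    -- Rotation by `Q` preserves row norms, and the normalization shrinks squared entries relative
    -- to division by `ν`, because `μ j ≥ ν`.
    have h2 : ∀ j, U i j ^ 2 ≤ (A * Q) i j ^ 2 / ν := by
      intro j
      have h3 : w j ^ 2 = (μ j)⁻¹ := by
        simp only [w, inv_pow, Real.sq_sqrt (hμ0 j).le]
      simp only [U, Matrix.mul_diagonal, mul_pow, h3, div_eq_mul_inv]
      gcongr
      exact hμlow j
    calc ∑ j, U i j ^ 2 ≤ ∑ j, (A * Q) i j ^ 2 / ν := Finset.sum_le_sum fun j _ => h2 j
      _ = (∑ j, A i j ^ 2) / ν := by rw [← Finset.sum_div, h1]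
      _ ≤ cI := by rw [div_le_iff₀ hν, mul_comm]; exact hrow i
  have hsv : ν ≤ singularValue (Matrix.diagonal μ) r := by
    refine le_singularValue hr hν.le fun x => ?_
    simp only [dotProduct, Matrix.mulVec_diagonal, Finset.mul_sum]
    refine Finset.sum_le_sum fun j _ => ?_
    have : ν ^ 2 ≤ μ j ^ 2 := pow_le_pow_left₀ hν.le (hμlow j) 2
    nlinarith [mul_le_mul_of_nonneg_right this (mul_self_nonneg (x j))]
  have hnorm : ‖(Matrix.diagonal μ : Matrix (Fin r) (Fin r) ℝ)‖ ≤ κ * ν := by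
    rw [Matrix.l2_opNorm_diagonal]
    refine (pi_norm_le_iff_of_nonneg (by positivity)).2 fun j => ?_
    rw [Real.norm_of_nonneg (hμ0 j).le]
    exact hμup j
  refine ⟨⟨U, Matrix.diagonal μ, Matrix.diagonal d⟩, ?_, by rw [Params.cov, hΛ],
    ⟨_, Matrix.mul_assoc A Q _⟩, _, hAU⟩
  exact
    { D_diag := Matrix.isDiag_diagonal d
      D_nonneg := fun i => by simpa using hd0 i
      D_sum := by simpa using hdsum
      D_max := fun i => by simpa using hdmax i
      U_orth := hUorth
      U_incoherent := incoherence_le hcI.le hrowU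
      Lam_diag := Matrix.isDiag_diagonal μ
      Lam_nonneg := fun j => by simpa using (hμ0 j).le
      Lam_cond := by
        rw [div_le_iff₀ (hν.trans_le hsv)]
        exact hnorm.trans (by gcongr)
      Lam_lower := hsv }

/-- A normal vector `q` of the first column space and a vector `A₂ x` of the second one bound the
angle from below. -/
theorem sq_dotProduct_le_sinTheta {U₁ U₂ A₁ A₂ : Matrix (Fin p) (Fin r) ℝ}
    {M N : Matrix (Fin r) (Fin r) ℝ} (h₂ : OrthonormalCols U₂)
    (hM : U₁ = A₁ * M) (hN : A₂ = U₂ * N) {q : Fin p → ℝ} (hq : A₁ᵀ *ᵥ q = 0) (x : Fin r → ℝ) :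
    (q ⬝ᵥ (A₂ *ᵥ x)) ^ 2 ≤
      sinTheta U₁ U₂ ^ 2 * ((q ⬝ᵥ q) * ((A₂ *ᵥ x) ⬝ᵥ (A₂ *ᵥ x))) := by
  have hq' : U₁ᵀ *ᵥ q = 0 := by
    rw [hM, Matrix.transpose_mul, ← Matrix.mulVec_mulVec, hq, Matrix.mulVec_zero]
  have h1 : q ⬝ᵥ (A₂ *ᵥ x) = q ⬝ᵥ (((1 - U₁ * U₁ᵀ) * U₂) *ᵥ (N *ᵥ x)) := by
    rw [Matrix.sub_mul, Matrix.one_mul, Matrix.sub_mulVec, dotProduct_sub, Matrix.mul_assoc,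
      ← Matrix.mulVec_mulVec _ U₁, dotProduct_mulVec_comm U₁, hq', zero_dotProduct, sub_zero,
      Matrix.mulVec_mulVec, ← hN]
  have h2 : (A₂ *ᵥ x) ⬝ᵥ (A₂ *ᵥ x) = (N *ᵥ x) ⬝ᵥ (N *ᵥ x) := by
    rw [hN, ← Matrix.mulVec_mulVec, h₂.mulVec_dotProduct]
  rw [h1, h2]
  refine (dotProduct_sq_le _ _).trans ?_
  have h3 := mulVec_dotProduct_self_le ((1 - U₁ * U₁ᵀ) * U₂) (N *ᵥ x)
  calc _ ≤ (q ⬝ᵥ q) * (‖(1 - U₁ * U₁ᵀ) * U₂‖ ^ 2 * ((N *ᵥ x) ⬝ᵥ (N *ᵥ x))) :=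
        mul_le_mul_of_nonneg_left h3 (dotProduct_self_nonneg' q)
    _ = _ := by rw [sinTheta]; ring

/-- `r` orthonormal columns of height `1 / √b`, supported on consecutive disjoint blocks of length
`b` which start at position `o`. -/
noncomputable def blockCols (p r b o : ℕ) : Matrix (Fin p) (Fin r) ℝ :=
  Matrix.of fun i j => if o ≤ (i : ℕ) ∧ ((i : ℕ) - o) / b = j then (√(b : ℝ))⁻¹ else 0

theorem blockCols_of_lt {b o : ℕ} {i : Fin p} (hi : (i : ℕ) < o) (j : Fin r) :
    blockCols p r b o i j = 0 := by
  simp [blockCols, not_le.2 hi]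

theorem blockCols_row_sq_le {b o : ℕ} (i : Fin p) :
    ∑ j, blockCols p r b o i j ^ 2 ≤ (b : ℝ)⁻¹ := by
  by_cases h : o ≤ (i : ℕ) ∧ ((i : ℕ) - o) / b < r
  · rw [Finset.sum_eq_single (⟨((i : ℕ) - o) / b, h.2⟩ : Fin r)]
    · simp [blockCols, h.1]
    · intro j _ hj
      have : ¬ (((i : ℕ) - o) / b = (j : ℕ)) := fun e => hj (Fin.ext e.symm)
      simp [blockCols, this]
    · simp
  · rw [Finset.sum_eq_zero]
    · positivity
    · intro j _
      have : ¬ (o ≤ (i : ℕ) ∧ ((i : ℕ) - o) / b = j) := fun e => h ⟨e.1, e.2 ▸ j.2⟩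
      simp [blockCols, this]

theorem orthonormalCols_blockCols {b o : ℕ} (hb : 0 < b) (hp : o + r * b ≤ p) :
    OrthonormalCols (blockCols p r b o) := by
  ext j k
  rw [Matrix.mul_apply, Matrix.one_apply]
  simp only [Matrix.transpose_apply]
  by_cases hjk : j = k
  · subst hjk
    have h1 : ∀ i : Fin p, blockCols p r b o i j * blockCols p r b o i j =
        if o ≤ (i : ℕ) ∧ ((i : ℕ) - o) / b = j then (b : ℝ)⁻¹ else 0 := by
      intro i
      by_cases h : o ≤ (i : ℕ) ∧ ((i : ℕ) - o) / b = j
      · simp only [blockCols, Matrix.of_apply, h, and_self, if_true]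
        rw [← mul_inv, Real.mul_self_sqrt (by positivity)]
      · simp only [blockCols, Matrix.of_apply, h, if_false, mul_zero]
    simp only [h1, if_true]
    rw [← Finset.sum_filter, Finset.sum_const, nsmul_eq_mul]
    have hcard : (Finset.univ.filter fun i : Fin p => o ≤ (i : ℕ) ∧ ((i : ℕ) - o) / b = j).card =
        b := by
      have hj : (j : ℕ) * b + b ≤ r * b := by
        have := Nat.mul_le_mul_right b j.2
        rwa [Nat.succ_mul] at this
      refine (Finset.card_bij (s := Finset.univ)
        (fun (t : Fin b) _ => (⟨o + (j * b + t), by omega⟩ : Fin p)) ?_ ?_ ?_).symm.trans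
        (by simp)
      · intro t _
        simp only [Finset.mem_filter, Finset.mem_univ, true_and]
        refine ⟨by omega, ?_⟩
        rw [Nat.add_sub_cancel_left]
        exact Nat.div_eq_of_lt_le (by omega) (by rw [Nat.succ_mul]; omega)
      · intro t _ t' _ h
        simp only [Fin.mk.injEq] at h
        exact Fin.ext (by omega)
      · intro i hi
        simp only [Finset.mem_filter, Finset.mem_univ, true_and] at hi
        have h2 := Nat.div_add_mod ((i : ℕ) - o) b
        rw [hi.2, mul_comm] at h2
        refine ⟨⟨((i : ℕ) - o) % b, Nat.mod_lt _ hb⟩, Finset.mem_univ _, Fin.ext ?_⟩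
        simp only
        omega
    rw [hcard]
    exact mul_inv_cancel₀ (by positivity)
  · simp only [hjk, if_false]
    refine Finset.sum_eq_zero fun i _ => ?_
    by_cases h : o ≤ (i : ℕ) ∧ ((i : ℕ) - o) / b = j
    · have : ¬ (o ≤ (i : ℕ) ∧ ((i : ℕ) - o) / b = k) := fun e =>
        hjk (Fin.ext (h.2.symm.trans e.2))
      simp [blockCols, this]
    · simp [blockCols, h]

end Construction

/-! ### Sign vectors and Hamming distance -/

section SignVectors

variable {m : ℕ}

/-- The vector with entries `± δ` and signs given by `s`. -/
def signVec (δ : ℝ) (s : Fin m → Bool) : Fin m → ℝ := fun k => if s k then δ else -δ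

theorem signVec_sq (δ : ℝ) (s : Fin m → Bool) (k : Fin m) : signVec δ s k ^ 2 = δ ^ 2 := by
  unfold signVec
  split_ifs <;> ring

theorem signVec_dotProduct_self (δ : ℝ) (s : Fin m → Bool) :
    signVec δ s ⬝ᵥ signVec δ s = m * δ ^ 2 := by
  simp [dotProduct, ← sq, signVec_sq]

theorem signVec_flip (δ : ℝ) (s : Fin m → Bool) (k : Fin m) :
    signVec δ (flip k s) = Function.update (signVec δ s) k (-signVec δ s k) := by
  ext j
  by_cases h : j = k
  · subst h
    cases hs : s j <;> simp [signVec, flip, hs]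
  · simp [signVec, flip, h]

theorem signVec_sub_dotProduct_self (δ : ℝ) (s s' : Fin m → Bool) :
    (signVec δ s - signVec δ s') ⬝ᵥ (signVec δ s - signVec δ s') =
      4 * δ ^ 2 * (Finset.univ.filter fun k => s k ≠ s' k).card := by
  rw [Finset.card_filter, Nat.cast_sum, Finset.mul_sum]
  refine Finset.sum_congr rfl fun k _ => ?_
  cases hs : s k <;> cases hs' : s' k <;> simp [signVec, hs, hs'] <;> ring

theorem signVec_dotProduct (δ : ℝ) (s s' : Fin m → Bool) :
    signVec δ s ⬝ᵥ signVec δ s' =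
      m * δ ^ 2 - 2 * δ ^ 2 * (Finset.univ.filter fun k => s k ≠ s' k).card := by
  have h := signVec_sub_dotProduct_self δ s s'
  rw [sub_dotProduct, dotProduct_sub, dotProduct_sub, signVec_dotProduct_self,
    signVec_dotProduct_self, dotProduct_comm (signVec δ s') (signVec δ s)] at h
  linarith

theorem update_dotProduct_self_le (a : Fin m → ℝ) (k : Fin m) :
    Function.update a k 0 ⬝ᵥ Function.update a k 0 ≤ a ⬝ᵥ a :=
  Finset.sum_le_sum fun j _ => by
    by_cases h : j = k
    · subst h
      simpa using mul_self_nonneg (a j)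
    · simp [h]

theorem update_eq_add_single (a : Fin m → ℝ) (k : Fin m) (c : ℝ) :
    Function.update a k c = Function.update a k 0 + c • Pi.single k 1 := by
  ext j
  by_cases h : j = k
  · subst h
    simp
  · simp [h]

end SignVectors

/-! ### The quadratic form of a factor plus a diagonal -/

section QuadraticForm

variable {p r : ℕ}

theorem quadForm_mul_transpose_add_diagonal (A : Matrix (Fin p) (Fin r) ℝ) (d t : Fin p → ℝ) :
    t ⬝ᵥ (A * Aᵀ + Matrix.diagonal d) *ᵥ t =
      (Aᵀ *ᵥ t) ⬝ᵥ (Aᵀ *ᵥ t) + ∑ i, d i * t i ^ 2 := by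
  rw [Matrix.add_mulVec, dotProduct_add, ← Matrix.mulVec_mulVec, dotProduct_mulVec_comm]
  congr 1
  refine Finset.sum_congr rfl fun i _ => ?_
  rw [Matrix.mulVec_diagonal]
  ring

theorem posSemidef_mul_transpose_add_diagonal (A : Matrix (Fin p) (Fin r) ℝ) {d : Fin p → ℝ}
    (hd : ∀ i, 0 ≤ d i) : (A * Aᵀ + Matrix.diagonal d).PosSemidef := by
  refine Matrix.PosSemidef.add ?_ (Matrix.PosSemidef.diagonal hd)
  have := Matrix.posSemidef_self_mul_conjTranspose A
  rwa [Matrix.conjTranspose_eq_transpose_of_trivial] at this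

end QuadraticForm

section NoisyRow

/-! ### Regression of one noisy coordinate on the signal -/

variable {p r : ℕ} {V : Matrix (Fin p) (Fin r) ℝ} {i₀ : Fin p}

/-- The factor `√ν (V + e_{i₀} aᵀ)`. -/
noncomputable def rowFactor (ν : ℝ) (V : Matrix (Fin p) (Fin r) ℝ) (i₀ : Fin p) (a : Fin r → ℝ) :
    Matrix (Fin p) (Fin r) ℝ :=
  √ν • (V + Matrix.vecMulVec (Pi.single i₀ 1) a)

theorem rowFactor_mulVec (ν : ℝ) (a x : Fin r → ℝ) :
    rowFactor ν V i₀ a *ᵥ x = √ν • (V *ᵥ x + (a ⬝ᵥ x) • Pi.single i₀ 1) := by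
  rw [rowFactor, Matrix.smul_mulVec, Matrix.add_mulVec, Matrix.vecMulVec_mulVec]
  simp

theorem rowFactor_transpose_mulVec (ν : ℝ) (a : Fin r → ℝ) (t : Fin p → ℝ) :
    (rowFactor ν V i₀ a)ᵀ *ᵥ t = √ν • (Vᵀ *ᵥ t + t i₀ • a) := by
  rw [rowFactor, Matrix.transpose_smul, Matrix.transpose_add, Matrix.smul_mulVec,
    Matrix.add_mulVec, Matrix.transpose_vecMulVec, Matrix.vecMulVec_mulVec]
  simp

theorem mulVec_apply_eq_zero (hV0 : ∀ j, V i₀ j = 0) (x : Fin r → ℝ) : (V *ᵥ x) i₀ = 0 := by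
  simp [Matrix.mulVec, dotProduct, hV0]

theorem rowFactor_mulVec_dotProduct_self {ν : ℝ} (hν : 0 ≤ ν) (hV : OrthonormalCols V)
    (hV0 : ∀ j, V i₀ j = 0) (a x : Fin r → ℝ) :
    (rowFactor ν V i₀ a *ᵥ x) ⬝ᵥ (rowFactor ν V i₀ a *ᵥ x) = ν * (x ⬝ᵥ x + (a ⬝ᵥ x) ^ 2) := by
  rw [rowFactor_mulVec, smul_dotProduct, dotProduct_smul, smul_smul, Real.mul_self_sqrt hν,
    add_dotProduct, dotProduct_add, dotProduct_add, hV.mulVec_dotProduct]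
  simp [mulVec_apply_eq_zero hV0]
  ring_nf
  simp

theorem two_point_rowFactor {n : ℕ} {ν σ : ℝ} (hν : 0 ≤ ν) (hσ : 0 < σ) (hV : OrthonormalCols V)
    (hV0 : ∀ j, V i₀ j = 0) (a : Fin r → ℝ) (j : Fin r) {η : ℝ}
    (hη : n * (ν * η ^ 2) ≤ σ ^ 2 / 4)
    {B : Set (Fin n → EuclideanSpace ℝ (Fin p))} (hB : MeasurableSet B) :
    ENNReal.ofReal (3 / 8) ≤
      sampleLaw n (rowFactor ν V i₀ (Function.update a j η) *
        (rowFactor ν V i₀ (Function.update a j η))ᵀ +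
          Matrix.diagonal (Pi.single i₀ (σ ^ 2))) B +
      sampleLaw n (rowFactor ν V i₀ (Function.update a j (-η)) *
        (rowFactor ν V i₀ (Function.update a j (-η)))ᵀ +
          Matrix.diagonal (Pi.single i₀ (σ ^ 2))) Bᶜ := by
  set a₀ := Function.update a j 0
  set e : Fin r → ℝ := Pi.single j 1
  -- Since `Vᵀ h = η e` and `h i₀ = 0`, pairing `h` with the noiseless vector extracts `η` times its
  -- `j`-th factor. Adding this to coordinate `i₀` restores the missing loading `η`, and the
  -- predictor has variance `ν η²`.
  let h : Fin p → ℝ := η • (V *ᵥ e)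
  have hd : ∀ i, 0 ≤ (Pi.single i₀ (σ ^ 2) : Fin p → ℝ) i := fun i => by
    by_cases hi : i = i₀
    · subst hi
      simp [sq_nonneg]
    · simp [hi]
  have hsum : ∀ t : Fin p → ℝ, ∑ i, (Pi.single i₀ (σ ^ 2) : Fin p → ℝ) i * t i ^ 2 =
      σ ^ 2 * t i₀ ^ 2 := fun t => by
    simp [Pi.single_apply]
  have hh0 : h i₀ = 0 := by simp [h, mulVec_apply_eq_zero hV0]
  have hVh : Vᵀ *ᵥ h = η • e := by
    simp only [h]
    rw [Matrix.mulVec_smul, Matrix.mulVec_mulVec, hV, Matrix.one_mulVec]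
  have hshift : ∀ (t : Fin p → ℝ) (c : ℝ), (rowFactor ν V i₀ a₀)ᵀ *ᵥ (t + (c * t i₀) • h) =
      (rowFactor ν V i₀ (a₀ + (c * η) • e))ᵀ *ᵥ t := by
    intro t c
    rw [rowFactor_transpose_mulVec, rowFactor_transpose_mulVec, Matrix.mulVec_add,
      Matrix.mulVec_smul, hVh]
    simp only [Pi.add_apply, Pi.smul_apply, hh0, smul_zero, add_zero]
    module
  have hquad : ∀ (t : Fin p → ℝ) (c : ℝ),
      t ⬝ᵥ (rowFactor ν V i₀ (a₀ + (c * η) • e) * (rowFactor ν V i₀ (a₀ + (c * η) • e))ᵀ +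
        Matrix.diagonal (Pi.single i₀ (σ ^ 2))) *ᵥ t =
      (t + (c * t i₀) • h) ⬝ᵥ (rowFactor ν V i₀ a₀ * (rowFactor ν V i₀ a₀)ᵀ +
        Matrix.diagonal 0) *ᵥ (t + (c * t i₀) • h) + σ ^ 2 * t i₀ ^ 2 := by
    intro t c
    rw [quadForm_mul_transpose_add_diagonal, quadForm_mul_transpose_add_diagonal, hshift, hsum]
    simp
  rw [update_eq_add_single a j η, update_eq_add_single a j (-η)]
  refine two_point_sampleLaw (posSemidef_mul_transpose_add_diagonal (rowFactor ν V i₀ a₀)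
    (d := 0) fun _ => le_rfl) (posSemidef_mul_transpose_add_diagonal _ hd)
    (posSemidef_mul_transpose_add_diagonal _ hd) i₀ h (v := σ ^ 2) (by positivity)
    (fun t => ?_) (fun t => ?_) ?_ hB
  · simpa using hquad t 1
  · simpa [sub_eq_add_neg] using hquad t (-1)
  · rw [quadForm_mul_transpose_add_diagonal, rowFactor_transpose_mulVec, hVh, hh0, zero_smul,
      add_zero, smul_smul, smul_dotProduct, dotProduct_smul]
    have : √ν * √ν = ν := Real.mul_self_sqrt hν
    refine le_trans (le_of_eq ?_) hη
    simp [e]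
    left
    linear_combination η ^ 2 * this

/-- The vector `q = e_{i₀} - V a₁` is normal to the first column space. Paired with `A₂ (a₁ - a₂)`
it gives `-√ν |a₁ - a₂|²`, while the squared lengths are at most `2` and `2ν |a₁ - a₂|²`. -/
theorem sinTheta_rowFactor {ν : ℝ} (hν : 0 < ν) (hV : OrthonormalCols V)
    (hV0 : ∀ j, V i₀ j = 0) {a₁ a₂ : Fin r → ℝ} (h₁ : a₁ ⬝ᵥ a₁ ≤ 1) (h₂ : a₂ ⬝ᵥ a₂ ≤ 1)
    {U₁ U₂ : Matrix (Fin p) (Fin r) ℝ} {M N : Matrix (Fin r) (Fin r) ℝ} (hU₂ : OrthonormalCols U₂)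
    (hM : U₁ = rowFactor ν V i₀ a₁ * M) (hN : rowFactor ν V i₀ a₂ = U₂ * N) :
    (a₁ - a₂) ⬝ᵥ (a₁ - a₂) ≤ 4 * sinTheta U₁ U₂ ^ 2 := by
  let q : Fin p → ℝ := Pi.single i₀ 1 - V *ᵥ a₁
  set x := a₁ - a₂
  have hVe : Vᵀ *ᵥ (Pi.single i₀ 1 : Fin p → ℝ) = 0 := by
    ext j
    simp [hV0]
  have hq0 : q i₀ = 1 := by simp [q, mulVec_apply_eq_zero hV0]
  have hq : (rowFactor ν V i₀ a₁)ᵀ *ᵥ q = 0 := by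
    rw [rowFactor_transpose_mulVec, hq0]
    simp only [q]
    rw [Matrix.mulVec_sub, hVe, Matrix.mulVec_mulVec, hV, Matrix.one_mulVec]
    simp
  have main := sq_dotProduct_le_sinTheta hU₂ hM hN hq x
  have hqx : q ⬝ᵥ (rowFactor ν V i₀ a₂ *ᵥ x) = √ν * (-(x ⬝ᵥ x)) := by
    rw [rowFactor_mulVec, dotProduct_smul, dotProduct_add, dotProduct_smul, dotProduct_single,
      hq0]
    simp only [q]
    rw [sub_dotProduct, hV.mulVec_dotProduct, single_dotProduct, mulVec_apply_eq_zero hV0]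
    simp only [x, sub_dotProduct, smul_eq_mul]
    ring
  have hqq : q ⬝ᵥ q = 1 + a₁ ⬝ᵥ a₁ := by
    simp only [q]
    rw [sub_dotProduct, dotProduct_sub, dotProduct_sub, hV.mulVec_dotProduct]
    simp [mulVec_apply_eq_zero hV0]
  rw [hqx, hqq, rowFactor_mulVec_dotProduct_self hν.le hV hV0, mul_pow, Real.sq_sqrt hν.le] at main
  have hx0 := dotProduct_self_nonneg' x
  have hcs := dotProduct_sq_le a₂ x
  have h3 : (1 + a₁ ⬝ᵥ a₁) * (ν * (x ⬝ᵥ x + (a₂ ⬝ᵥ x) ^ 2)) ≤ 2 * (ν * (2 * (x ⬝ᵥ x))) := by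
    have := dotProduct_self_nonneg' a₁
    have : (a₂ ⬝ᵥ x) ^ 2 ≤ x ⬝ᵥ x := by nlinarith
    gcongr <;> linarith
  rcases hx0.eq_or_lt with h0 | h0
  · rw [← h0]
    positivity
  · have h4 := main.trans (mul_le_mul_of_nonneg_left h3 (sq_nonneg (sinTheta U₁ U₂)))
    have h5 : (ν * (x ⬝ᵥ x)) * (x ⬝ᵥ x) ≤ (ν * (x ⬝ᵥ x)) * (4 * sinTheta U₁ U₂ ^ 2) := by
      nlinarith
    exact le_of_mul_le_mul_left h5 (by positivity)

/-- A perturbed row of squared length `rδ²` raises the top of the Gram spectrum from `ν` to at most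
`ν(1 + rδ²)`: hence the condition with `κ - 1`. The condition with `cI` is incoherence of that row,
the one with `1` serves the angle bound, and the last one serves the test. -/
theorem lower_bound_noisyRow {p n r b : ℕ} {cI κ σsum σmax ν δ : ℝ} (hr : 1 ≤ r) (hcI : 0 < cI)
    (hκ : 1 < κ) (hν : 0 < ν) (hσ : 0 < σmax) (hσσ : σmax ≤ σsum) (hb : 0 < b)
    (hbcI : (b : ℝ)⁻¹ ≤ cI) (hp : 1 + r * b ≤ p) (hδ : 0 ≤ δ) (hδκ : r * δ ^ 2 ≤ κ - 1)
    (hδ1 : r * δ ^ 2 ≤ 1) (hδcI : r * δ ^ 2 ≤ cI) (hδn : n * (ν * δ ^ 2) ≤ σmax ^ 2 / 4) :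
    ENNReal.ofReal (3 / 32 * (√r * δ)) ≤ minimaxRisk cI κ p n r σsum σmax ν := by
  let i₀ : Fin p := ⟨0, by omega⟩
  -- Starting the blocks at 1 leaves row 0 free for the noisy coordinate.
  let V := blockCols p r b 1
  have hV : OrthonormalCols V := orthonormalCols_blockCols hb hp
  have hV0 : ∀ j, V i₀ j = 0 := blockCols_of_lt (by simp [i₀])
  have hex : ∀ s : Fin r → Bool, ∃ θ : Params p r, InClass cI κ σsum σmax ν θ ∧
      θ.cov = rowFactor ν V i₀ (signVec δ s) * (rowFactor ν V i₀ (signVec δ s))ᵀ +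
        Matrix.diagonal (Pi.single i₀ (σmax ^ 2)) ∧
      (∃ M : Matrix (Fin r) (Fin r) ℝ, θ.U = rowFactor ν V i₀ (signVec δ s) * M) ∧
      ∃ N : Matrix (Fin r) (Fin r) ℝ, rowFactor ν V i₀ (signVec δ s) = θ.U * N := by
    intro s
    refine exists_params hr hcI hκ hν _ _ (fun i => ?_) ?_ (fun i => ?_) (fun x => ?_)
      (fun x => ?_) (fun i => ?_)
    · by_cases hi : i = i₀
      · subst hi
        simp [sq_nonneg]
      · simp [hi]
    · rw [Finset.sum_pi_single']
      simp only [Finset.mem_univ, if_true]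
      gcongr
    · by_cases hi : i = i₀
      · subst hi
        simp
      · simp [hi, sq_nonneg]
    · rw [rowFactor_mulVec_dotProduct_self hν.le hV hV0]
      nlinarith [sq_nonneg (signVec δ s ⬝ᵥ x)]
    · rw [rowFactor_mulVec_dotProduct_self hν.le hV hV0]
      have h1 := dotProduct_sq_le (signVec δ s) x
      rw [signVec_dotProduct_self] at h1
      have h2 := mul_le_mul_of_nonneg_right hδκ (dotProduct_self_nonneg' x)
      have h3 : ν * (x ⬝ᵥ x + (signVec δ s ⬝ᵥ x) ^ 2) ≤ ν * (κ * (x ⬝ᵥ x)) := by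
        gcongr
        linarith
      linarith
    · have hs : √ν ^ 2 = ν := Real.sq_sqrt hν.le
      by_cases hi : i = i₀
      · subst hi
        simp only [rowFactor, Matrix.smul_apply, Matrix.add_apply, hV0, Matrix.vecMulVec_apply,
          Pi.single_eq_same, smul_eq_mul, mul_pow, hs, zero_add, one_mul, signVec_sq]
        rw [Finset.sum_const, Finset.card_univ, Fintype.card_fin, nsmul_eq_mul]
        nlinarith
      · simp only [rowFactor, Matrix.smul_apply, Matrix.add_apply, Matrix.vecMulVec_apply,
          Pi.single_eq_of_ne hi, smul_eq_mul, mul_pow, hs, zero_mul, add_zero]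
        rw [← Finset.mul_sum]
        gcongr
        exact (blockCols_row_sq_le i).trans hbcI
  choose θ hθ hcov hfac using hex
  choose M hM using fun s => (hfac s).1
  choose N hN using fun s => (hfac s).2
  refine assouad hr θ hθ hδ (fun s s' => ?_) (fun s k B hB => ?_)
  · have h := sinTheta_rowFactor hν hV hV0 ((signVec_dotProduct_self δ s).trans_le hδ1)
      ((signVec_dotProduct_self δ s').trans_le hδ1) (hθ s').U_orth (hM s) (hN s')
    rw [signVec_sub_dotProduct_self] at h
    linarith
  · rw [hcov, hcov, signVec_flip]
    have h := two_point_rowFactor (n := n) hν.le hσ hV hV0 (signVec δ s) k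
      (η := signVec δ s k) (by rwa [signVec_sq]) hB
    rwa [Function.update_eq_self] at h

end NoisyRow

section Spike

/-! ### A spike in isotropic noise -/

variable {p r : ℕ} {V : Matrix (Fin p) (Fin r) ℝ} {j₀ : Fin r}

/-- The factor `√ν (V + w e_{j₀}ᵀ)`. -/
noncomputable def spikeFactor (ν : ℝ) (V : Matrix (Fin p) (Fin r) ℝ) (j₀ : Fin r)
    (w : Fin p → ℝ) : Matrix (Fin p) (Fin r) ℝ :=
  √ν • (V + Matrix.vecMulVec w (Pi.single j₀ 1))

theorem spikeFactor_mulVec (ν : ℝ) (w : Fin p → ℝ) (x : Fin r → ℝ) :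
    spikeFactor ν V j₀ w *ᵥ x = √ν • (V *ᵥ x + x j₀ • w) := by
  rw [spikeFactor, Matrix.smul_mulVec, Matrix.add_mulVec, Matrix.vecMulVec_mulVec]
  simp

theorem spikeFactor_transpose_mulVec (ν : ℝ) (w t : Fin p → ℝ) :
    (spikeFactor ν V j₀ w)ᵀ *ᵥ t = √ν • (Vᵀ *ᵥ t + (w ⬝ᵥ t) • Pi.single j₀ 1) := by
  rw [spikeFactor, Matrix.transpose_smul, Matrix.transpose_add, Matrix.smul_mulVec,
    Matrix.add_mulVec, Matrix.transpose_vecMulVec, Matrix.vecMulVec_mulVec]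
  simp

theorem spikeFactor_transpose_mulVec_dotProduct_self {ν : ℝ} (hν : 0 ≤ ν)
    (hVj : ∀ i, V i j₀ = 0) (w t : Fin p → ℝ) :
    ((spikeFactor ν V j₀ w)ᵀ *ᵥ t) ⬝ᵥ ((spikeFactor ν V j₀ w)ᵀ *ᵥ t) =
      ν * ((Vᵀ *ᵥ t) ⬝ᵥ (Vᵀ *ᵥ t) + (w ⬝ᵥ t) ^ 2) := by
  have h0 : (Vᵀ *ᵥ t) j₀ = 0 := by simp [Matrix.mulVec, dotProduct, hVj]
  rw [spikeFactor_transpose_mulVec, smul_dotProduct, dotProduct_smul, smul_smul,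
    Real.mul_self_sqrt hν, add_dotProduct, dotProduct_add, dotProduct_add]
  simp [h0]
  ring_nf
  simp

theorem spikeFactor_mulVec_dotProduct_self {ν : ℝ} (hν : 0 ≤ ν)
    (hV : ∀ x, (V *ᵥ x) ⬝ᵥ (V *ᵥ x) = x ⬝ᵥ x - x j₀ ^ 2) {w : Fin p → ℝ} (hw : w ⬝ᵥ w = 1)
    (hVw : Vᵀ *ᵥ w = 0) (x : Fin r → ℝ) :
    (spikeFactor ν V j₀ w *ᵥ x) ⬝ᵥ (spikeFactor ν V j₀ w *ᵥ x) = ν * (x ⬝ᵥ x) := by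
  have h : w ⬝ᵥ (V *ᵥ x) = 0 := by rw [dotProduct_mulVec_comm, hVw, zero_dotProduct]
  rw [spikeFactor_mulVec, smul_dotProduct, dotProduct_smul, smul_smul, Real.mul_self_sqrt hν,
    add_dotProduct, dotProduct_add, dotProduct_add, hV]
  simp only [dotProduct_smul, smul_dotProduct, dotProduct_comm (V *ᵥ x) w, h, hw, smul_eq_mul]
  ring

/-- Coordinate `i` is regressed on the other coordinates. The predictor variance is at most `ν²η² /
(σ² + ν)` and the residual variance at least `σ²`, which explains the condition on `n`. -/
theorem two_point_spikeFactor {n : ℕ} {ν σ : ℝ} (hν : 0 < ν) (hσ : 0 < σ)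
    (hVj : ∀ i, V i j₀ = 0) {w₀ : Fin p → ℝ} (hw₀ : w₀ ⬝ᵥ w₀ ≤ 1) (hVw : Vᵀ *ᵥ w₀ = 0)
    {d : Fin p → ℝ} (hd : ∀ i, 0 ≤ d i) (hdw : ∀ i, d i * w₀ i = σ ^ 2 * w₀ i)
    {i : Fin p} (hw₀i : w₀ i = 0) (hdi : d i = σ ^ 2) {η : ℝ}
    (hη : n * (ν ^ 2 * η ^ 2) ≤ σ ^ 2 * (σ ^ 2 + ν) / 4)
    {B : Set (Fin n → EuclideanSpace ℝ (Fin p))} (hB : MeasurableSet B) :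
    ENNReal.ofReal (3 / 8) ≤
      sampleLaw n (spikeFactor ν V j₀ (w₀ + η • Pi.single i 1) *
        (spikeFactor ν V j₀ (w₀ + η • Pi.single i 1))ᵀ + Matrix.diagonal d) B +
      sampleLaw n (spikeFactor ν V j₀ (w₀ + (-η) • Pi.single i 1) *
        (spikeFactor ν V j₀ (w₀ + (-η) • Pi.single i 1))ᵀ + Matrix.diagonal d) Bᶜ := by
  set β := w₀ ⬝ᵥ w₀
  have hβ0 : 0 ≤ β := dotProduct_self_nonneg' w₀
  have hσ2 : 0 < σ ^ 2 := by positivity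
  set D := σ ^ 2 + ν * β
  have hD : 0 < D := by positivity
  -- Regression coefficient: `w₀` is an eigenvector of the base covariance with eigenvalue `D`, and
  -- the cross-covariance with coordinate `i` is `νη w₀`.
  set γ := ν * η / D
  have hγ : γ * D = ν * η := div_mul_cancel₀ _ hD.ne'
  let d₀ := Function.update d i 0
  have hd₀ : ∀ k, 0 ≤ d₀ k := fun k => by
    by_cases h : k = i
    · subst h
      simp [d₀]
    · simpa [d₀, h] using hd k
  have hd₀w : ∀ k, d₀ k * w₀ k = σ ^ 2 * w₀ k := fun k => by
    by_cases h : k = i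
    · subst h
      simp [hw₀i]
    · simpa [d₀, h] using hdw k
  have hdd₀ : ∀ t : Fin p → ℝ, ∑ k, d k * t k ^ 2 = ∑ k, d₀ k * t k ^ 2 + σ ^ 2 * t i ^ 2 := by
    intro t
    rw [← Finset.add_sum_erase _ _ (Finset.mem_univ i),
      ← Finset.add_sum_erase _ (fun k => d₀ k * t k ^ 2) (Finset.mem_univ i), hdi]
    have : ∑ k ∈ Finset.univ.erase i, d k * t k ^ 2 =
        ∑ k ∈ Finset.univ.erase i, d₀ k * t k ^ 2 :=
      Finset.sum_congr rfl fun k hk => by simp [d₀, Finset.ne_of_mem_erase hk]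
    rw [this]
    simp only [d₀, Function.update_self]
    ring
  let h : Fin p → ℝ := γ • w₀
  have hnoise : ∀ (t : Fin p → ℝ) (c : ℝ), ∑ k, d₀ k * (t + c • h) k ^ 2 =
      ∑ k, d₀ k * t k ^ 2 + 2 * c * γ * σ ^ 2 * (w₀ ⬝ᵥ t) + c ^ 2 * γ ^ 2 * σ ^ 2 * β := by
    intro t c
    simp only [β, dotProduct, Finset.mul_sum, ← Finset.sum_add_distrib]
    refine Finset.sum_congr rfl fun k _ => ?_
    simp only [h, Pi.add_apply, Pi.smul_apply, smul_eq_mul]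
    linear_combination (2 * c * γ * t k + c ^ 2 * γ ^ 2 * w₀ k) * hd₀w k
  have hbase : ∀ (t : Fin p → ℝ) (c : ℝ), (t + c • h) ⬝ᵥ
      (spikeFactor ν V j₀ w₀ * (spikeFactor ν V j₀ w₀)ᵀ + Matrix.diagonal d₀) *ᵥ (t + c • h) =
      ν * ((Vᵀ *ᵥ t) ⬝ᵥ (Vᵀ *ᵥ t) + (w₀ ⬝ᵥ t + c * γ * β) ^ 2) + (∑ k, d₀ k * t k ^ 2 +
        2 * c * γ * σ ^ 2 * (w₀ ⬝ᵥ t) + c ^ 2 * γ ^ 2 * σ ^ 2 * β) := by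
    intro t c
    rw [quadForm_mul_transpose_add_diagonal, hnoise,
      spikeFactor_transpose_mulVec_dotProduct_self hν.le hVj]
    have h1 : Vᵀ *ᵥ (t + c • h) = Vᵀ *ᵥ t := by
      simp only [h]
      rw [Matrix.mulVec_add, Matrix.mulVec_smul, Matrix.mulVec_smul, hVw]
      simp
    have h2 : w₀ ⬝ᵥ (t + c • h) = w₀ ⬝ᵥ t + c * γ * β := by
      simp only [h, dotProduct_add, dotProduct_smul, smul_eq_mul, β]
      ring
    rw [h1, h2]
  -- Residual variance: the full variance of coordinate `i` minus the variance `νηγβ` explained by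
  -- the predictor.
  let v := σ ^ 2 + ν * η ^ 2 - ν * η * γ * β
  have hγβ : ν * η * γ * β ≤ ν * η ^ 2 := by
    have h1 : ν * η * γ * β * D ≤ ν * η ^ 2 * D := by
      have e : ν * η * γ * β * D = ν * η ^ 2 * (ν * β) := by
        linear_combination ν * η * β * hγ
      rw [e]
      refine mul_le_mul_of_nonneg_left ?_ (by positivity)
      simp only [D]
      linarith
    exact le_of_mul_le_mul_right h1 hD
  have hv : σ ^ 2 ≤ v := by simp only [v]; linarith
  have hquad : ∀ (t : Fin p → ℝ) (c : ℝ), c ^ 2 = 1 →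
      t ⬝ᵥ (spikeFactor ν V j₀ (w₀ + (c * η) • Pi.single i 1) *
        (spikeFactor ν V j₀ (w₀ + (c * η) • Pi.single i 1))ᵀ + Matrix.diagonal d) *ᵥ t =
      (t + (c * t i) • h) ⬝ᵥ (spikeFactor ν V j₀ w₀ * (spikeFactor ν V j₀ w₀)ᵀ +
        Matrix.diagonal d₀) *ᵥ (t + (c * t i) • h) + v * t i ^ 2 := by
    intro t c hc
    rw [hbase, quadForm_mul_transpose_add_diagonal,
      spikeFactor_transpose_mulVec_dotProduct_self hν.le hVj, hdd₀, add_dotProduct,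
      smul_dotProduct, single_dotProduct]
    simp only [v, smul_eq_mul, one_mul]
    have hγ' : γ * (σ ^ 2 + ν * β) = ν * η := hγ
    linear_combination (ν * η ^ 2 - ν * η * γ * β) * t i ^ 2 * hc -
      (2 * c * t i * (w₀ ⬝ᵥ t) + c ^ 2 * t i ^ 2 * γ * β) * hγ'
  refine two_point_sampleLaw (posSemidef_mul_transpose_add_diagonal (spikeFactor ν V j₀ w₀) hd₀)
    (posSemidef_mul_transpose_add_diagonal _ hd) (posSemidef_mul_transpose_add_diagonal _ hd)
    i h (v := v) (hσ2.trans_le hv) (fun t => ?_) (fun t => ?_) ?_ hB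
  · simpa using hquad t 1 (by norm_num)
  · simpa [sub_eq_add_neg] using hquad t (-1) (by norm_num)
  · have h0 := hbase 0 1
    simp only [zero_add, one_smul, Matrix.mulVec_zero, dotProduct_zero] at h0
    rw [h0]
    have hn : (0 : ℝ) ≤ n := Nat.cast_nonneg n
    have e : ν * (γ * β) ^ 2 + γ ^ 2 * σ ^ 2 * β = ν * η * γ * β := by
      have hγ' : γ * (σ ^ 2 + ν * β) = ν * η := hγ
      linear_combination γ * β * hγ'
    have h1 : n * (ν * η * γ * β) ≤ σ ^ 2 / 4 := by
      have e2 : ν * η * γ * β * D = ν ^ 2 * η ^ 2 * β := by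
        linear_combination ν * η * β * hγ
      have h3 : n * (ν ^ 2 * η ^ 2) * β ≤ σ ^ 2 * (σ ^ 2 + ν) / 4 * β :=
        mul_le_mul_of_nonneg_right hη hβ0
      -- This is where `|w₀|² ≤ 1` enters: it gives `β / D ≤ 1 / (σ² + ν)`.
      have h4 : (σ ^ 2 + ν) * β ≤ D := by
        simp only [D]
        nlinarith
      have h5 : n * (ν * η * γ * β) * D ≤ σ ^ 2 / 4 * D := by
        calc n * (ν * η * γ * β) * D = n * (ν ^ 2 * η ^ 2) * β := by rw [mul_assoc, e2]; ring
          _ ≤ σ ^ 2 * (σ ^ 2 + ν) / 4 * β := h3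
          _ = σ ^ 2 / 4 * ((σ ^ 2 + ν) * β) := by ring
          _ ≤ _ := by gcongr
      exact le_of_mul_le_mul_right h5 hD
    simp
    calc _ = n * (ν * (γ * β) ^ 2 + γ ^ 2 * σ ^ 2 * β) := by ring
      _ ≤ σ ^ 2 / 4 := by rw [e]; exact h1
      _ ≤ v / 4 := by gcongr

/-- The component `q = w₂ - ρ w₁` of the second spike orthogonal to the first is also orthogonal to
the common columns, hence normal to the first column space. Testing it against the second spike
gives sinΘ² at least `1 - ρ²`. -/
theorem sinTheta_spikeFactor {ν : ℝ} (hν : 0 < ν)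
    (hV : ∀ x, (V *ᵥ x) ⬝ᵥ (V *ᵥ x) = x ⬝ᵥ x - x j₀ ^ 2) {w₁ w₂ : Fin p → ℝ}
    (hw₁ : w₁ ⬝ᵥ w₁ = 1) (hw₂ : w₂ ⬝ᵥ w₂ = 1) (hVw₁ : Vᵀ *ᵥ w₁ = 0) (hVw₂ : Vᵀ *ᵥ w₂ = 0)
    {U₁ U₂ : Matrix (Fin p) (Fin r) ℝ} {M N : Matrix (Fin r) (Fin r) ℝ} (hU₂ : OrthonormalCols U₂)
    (hM : U₁ = spikeFactor ν V j₀ w₁ * M) (hN : spikeFactor ν V j₀ w₂ = U₂ * N) :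
    1 - (w₁ ⬝ᵥ w₂) ^ 2 ≤ sinTheta U₁ U₂ ^ 2 := by
  set ρ := w₁ ⬝ᵥ w₂
  let q : Fin p → ℝ := w₂ - ρ • w₁
  have hq : (spikeFactor ν V j₀ w₁)ᵀ *ᵥ q = 0 := by
    rw [spikeFactor_transpose_mulVec]
    simp only [q]
    rw [Matrix.mulVec_sub, Matrix.mulVec_smul, hVw₁, hVw₂, dotProduct_sub, dotProduct_smul, hw₁]
    simp [ρ]
  have main := sq_dotProduct_le_sinTheta hU₂ hM hN hq (Pi.single j₀ 1)
  have hV0 : V *ᵥ (Pi.single j₀ 1) = 0 := by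
    have := hV (Pi.single j₀ 1)
    simpa using this
  have h1 : q ⬝ᵥ (spikeFactor ν V j₀ w₂ *ᵥ Pi.single j₀ 1) = √ν * (1 - ρ ^ 2) := by
    rw [spikeFactor_mulVec, hV0]
    simp only [q, Pi.single_eq_same, one_smul, zero_add, dotProduct_smul, sub_dotProduct,
      smul_dotProduct, hw₂, smul_eq_mul]
    ring
  have h2 : q ⬝ᵥ q = 1 - ρ ^ 2 := by
    simp only [q, dotProduct_sub, sub_dotProduct, smul_dotProduct, dotProduct_smul, hw₁, hw₂,
      dotProduct_comm w₂ w₁, smul_eq_mul]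
    ring
  rw [h1, h2, spikeFactor_mulVec_dotProduct_self hν.le hV hw₂ hVw₂, mul_pow,
    Real.sq_sqrt hν.le] at main
  simp only [dotProduct_single, Pi.single_eq_same, mul_one] at main
  rcases le_or_gt (1 - ρ ^ 2) 0 with h | h
  · exact h.trans (sq_nonneg _)
  · have h3 : ν * (1 - ρ ^ 2) * (1 - ρ ^ 2) ≤ ν * (1 - ρ ^ 2) * sinTheta U₁ U₂ ^ 2 := by linarith
    exact le_of_mul_le_mul_left h3 (by positivity)

end Spike

/-! ### Lower bound from a spike with random signs -/

section SpikeLowerBound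

variable {p r q m : ℕ}

/-- Extend a vector by zeros. -/
def pad (p : ℕ) (u : Fin q → ℝ) : Fin p → ℝ := fun i => if h : (i : ℕ) < q then u ⟨i, h⟩ else 0

theorem pad_eq_mulVec (u : Fin q → ℝ) : pad p u = blockCols p q 1 0 *ᵥ u := by
  ext i
  simp only [pad, Matrix.mulVec, dotProduct, blockCols, Matrix.of_apply]
  by_cases h : (i : ℕ) < q
  · rw [Finset.sum_eq_single (⟨i, h⟩ : Fin q)]
    · simp [h]
    · intro j _ hj
      have : ¬ ((i : ℕ) = j) := fun e => hj (Fin.ext e.symm)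
      simp [this]
    · simp
  · have h2 : ∀ j : Fin q, ¬ ((i : ℕ) = j) := fun j e => h (e ▸ j.2)
    simp [h, h2]

theorem pad_dotProduct_pad (hq : q ≤ p) (u v : Fin q → ℝ) : pad p u ⬝ᵥ pad p v = u ⬝ᵥ v := by
  rw [pad_eq_mulVec, pad_eq_mulVec]
  exact (orthonormalCols_blockCols one_pos (by omega)).mulVec_dotProduct u v

theorem pad_of_le (u : Fin q → ℝ) {i : Fin p} (hi : q ≤ (i : ℕ)) : pad p u i = 0 := by
  simp [pad, not_lt.2 hi]

theorem pad_update (hq : q ≤ p) (u : Fin q → ℝ) (k : Fin q) (c : ℝ) :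
    pad p (Function.update u k c) =
      pad p (Function.update u k 0) + c • Pi.single (Fin.castLE hq k) 1 := by
  ext i
  by_cases hi : (i : ℕ) < q
  · by_cases hk : i = Fin.castLE hq k
    · subst hk
      simp [pad]
    · have : (⟨i, hi⟩ : Fin q) ≠ k := fun e => hk (Fin.ext (by simp [← e]))
      simp [pad, hi, hk, this]
  · have hk : i ≠ Fin.castLE hq k := fun e => hi (by simp [e])
    simp [pad, hi, hk]

theorem append_dotProduct_append {m' : ℕ} (u v : Fin m → ℝ) (u' v' : Fin m' → ℝ) :
    Fin.append u u' ⬝ᵥ Fin.append v v' = u ⬝ᵥ v + u' ⬝ᵥ v' := by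
  simp [dotProduct, Fin.sum_univ_add]

theorem append_update_right {m' : ℕ} (u : Fin m → ℝ) (a : Fin m' → ℝ) (k : Fin m') (c : ℝ) :
    Fin.append u (Function.update a k c) =
      Function.update (Fin.append u a) (Fin.natAdd m k) c := by
  ext i
  refine Fin.addCases (fun j => ?_) (fun j => ?_) i
  · have : Fin.castAdd m' j ≠ Fin.natAdd m k := fun e => by
      have := congrArg Fin.val e
      simp at this
      omega
    simp [this]
  · by_cases h : j = k
    · subst h
      simp
    · have : Fin.natAdd m j ≠ Fin.natAdd m k := fun e => h (by simpa using e)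
      simp [h, this]

/-- A constant block of height `β` followed by a block `a`, extended by zeros. -/
def spikeVec (p : ℕ) (β : ℝ) (a : Fin m → ℝ) : Fin p → ℝ :=
  pad p (Fin.append (fun _ : Fin m => β) a)

theorem spikeVec_dotProduct (hm : m + m ≤ p) (β : ℝ) (a a' : Fin m → ℝ) :
    spikeVec p β a ⬝ᵥ spikeVec p β a' = m * β ^ 2 + a ⬝ᵥ a' := by
  rw [spikeVec, spikeVec, pad_dotProduct_pad hm, append_dotProduct_append]
  simp [dotProduct, sq]

theorem spikeVec_update (hm : m + m ≤ p) (β : ℝ) (a : Fin m → ℝ) (k : Fin m) (c : ℝ) :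
    spikeVec p β (Function.update a k c) = spikeVec p β (Function.update a k 0) +
      c • Pi.single (Fin.castLE hm (Fin.natAdd m k)) 1 := by
  rw [spikeVec, spikeVec, append_update_right, append_update_right, pad_update hm]

theorem spikeVec_natAdd (hm : m + m ≤ p) (β : ℝ) (a : Fin m → ℝ) (k : Fin m) :
    spikeVec p β a (Fin.castLE hm (Fin.natAdd m k)) = a k := by
  rw [spikeVec, pad, dif_pos (by simp)]
  exact Fin.append_right _ _ k

theorem spikeVec_sq_le {β δ c : ℝ} (hc : 0 ≤ c) (hβ : β ^ 2 ≤ c) (hδ : δ ^ 2 ≤ c)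
    (s : Fin m → Bool) (i : Fin p) : spikeVec p β (signVec δ s) i ^ 2 ≤ c := by
  simp only [spikeVec, pad]
  split_ifs with h
  · generalize (⟨i, h⟩ : Fin (m + m)) = j
    refine Fin.addCases (fun j => ?_) (fun j => ?_) j
    · simpa using hβ
    · rw [Fin.append_right, signVec_sq]
      exact hδ
  · simpa using hc

theorem lower_bound_spike {n b : ℕ} {cI κ σsum σmax ν σ δ : ℝ} (hr : 1 ≤ r) (hcI : 0 < cI)
    (hκ : 1 < κ) (hν : 0 < ν) (hσ : 0 < σ) (hσmax : σ ^ 2 ≤ σmax ^ 2)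
    (hσsum : 2 * m * σ ^ 2 ≤ σsum ^ 2) (hb : 0 < b) (hbcI : (b : ℝ)⁻¹ ≤ cI) (hbm : b ≤ m)
    (hp : m + m + r * b ≤ p) (hδ : 0 ≤ δ) (hδm : m * δ ^ 2 ≤ 1 / 2)
    (hδn : n * (ν ^ 2 * δ ^ 2) ≤ σ ^ 2 * (σ ^ 2 + ν) / 4) :
    ENNReal.ofReal (3 / 32 * (√m * δ)) ≤ minimaxRisk cI κ p n r σsum σmax ν := by
  have hm0 : 0 < m := hb.trans_le hbm
  have hmR : (0 : ℝ) < m := by exact_mod_cast hm0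
  have hmp : m + m ≤ p := by omega
  have hmcI : (m : ℝ)⁻¹ ≤ cI := le_trans (by gcongr) hbcI
  let j₀ : Fin r := ⟨0, hr⟩
  set W := blockCols p r b (m + m)
  have hW : OrthonormalCols W := orthonormalCols_blockCols hb hp
  -- The spike replaces column `j₀`; the other columns live beyond the first `2m` coordinates, so
  -- they are noiseless and orthogonal to every spike.
  set V := W.updateCol j₀ 0
  have hVj : ∀ i, V i j₀ = 0 := fun i => by simp [V]
  have hVi : ∀ i : Fin p, (i : ℕ) < m + m → ∀ j, V i j = 0 := fun i hi j => by
    by_cases h : j = j₀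
    · subst h
      exact hVj i
    · simpa [V, h] using blockCols_of_lt hi j
  have hVle : ∀ i j, V i j ^ 2 ≤ W i j ^ 2 := fun i j => by
    by_cases h : j = j₀
    · subst h
      simp [V, sq_nonneg]
    · simp [V, h]
  have hVmul : ∀ x, V *ᵥ x = W *ᵥ Function.update x j₀ 0 := fun x => by
    ext i
    simp only [Matrix.mulVec, dotProduct]
    refine Finset.sum_congr rfl fun j _ => ?_
    by_cases h : j = j₀
    · subst h
      simp [V]
    · simp [V, h]
  have hV : ∀ x, (V *ᵥ x) ⬝ᵥ (V *ᵥ x) = x ⬝ᵥ x - x j₀ ^ 2 := fun x => by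
    rw [hVmul, hW.mulVec_dotProduct]
    have h1 : x = Function.update x j₀ 0 + x j₀ • Pi.single j₀ 1 := by
      rw [← update_eq_add_single, Function.update_eq_self]
    conv_rhs => rw [h1]
    simp only [add_dotProduct, dotProduct_add, smul_dotProduct, dotProduct_smul,
      single_dotProduct, dotProduct_single, Function.update_self, Pi.single_eq_same, Pi.add_apply,
      Pi.smul_apply, smul_eq_mul]
    ring
  have hVw : ∀ u : Fin (m + m) → ℝ, Vᵀ *ᵥ pad p u = 0 := fun u => by
    ext j
    change ∑ i, V i j * pad p u i = 0
    refine Finset.sum_eq_zero fun i _ => ?_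
    by_cases hi : (i : ℕ) < m + m
    · simp [hVi i hi j]
    · rw [pad_of_le u (not_lt.1 hi), mul_zero]
  -- Height that makes the spike a unit vector. The constant block has mass at least `1/2`, so
  -- opposite sign patterns do not span the same line.
  set β : ℝ := √((m : ℝ)⁻¹ - δ ^ 2)
  have hδm' : δ ^ 2 ≤ (m : ℝ)⁻¹ := by
    rw [← one_div, le_div_iff₀ hmR]
    linarith
  have hβ : β ^ 2 = (m : ℝ)⁻¹ - δ ^ 2 := Real.sq_sqrt (by linarith)
  have hmβ : m * β ^ 2 = 1 - m * δ ^ 2 := by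
    rw [hβ, mul_sub, mul_inv_cancel₀ hmR.ne']
  set w : (Fin m → Bool) → Fin p → ℝ := fun s => spikeVec p β (signVec δ s)
  have hww : ∀ s, w s ⬝ᵥ w s = 1 := fun s => by
    simp only [w]
    rw [spikeVec_dotProduct hmp, signVec_dotProduct_self, hmβ]
    ring
  let d : Fin p → ℝ := fun i => if (i : ℕ) < m + m then σ ^ 2 else 0
  have hd0 : ∀ i, 0 ≤ d i := fun i => by
    simp only [d]
    split_ifs <;> positivity
  have hex : ∀ s : Fin m → Bool, ∃ θ : Params p r, InClass cI κ σsum σmax ν θ ∧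
      θ.cov = spikeFactor ν V j₀ (w s) * (spikeFactor ν V j₀ (w s))ᵀ + Matrix.diagonal d ∧
      (∃ M : Matrix (Fin r) (Fin r) ℝ, θ.U = spikeFactor ν V j₀ (w s) * M) ∧ ∃ N : Matrix (Fin r) (Fin r) ℝ, spikeFactor ν V j₀ (w s) = θ.U * N := by
    intro s
    refine exists_params hr hcI hκ hν _ _ hd0 ?_ (fun i => ?_) (fun x => ?_)
      (fun x => ?_) (fun i => ?_)
    · have h1 : ∀ i, d i = pad p (fun _ : Fin (m + m) => σ) i *
          pad p (fun _ : Fin (m + m) => σ) i := by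
        intro i
        by_cases hi : (i : ℕ) < m + m <;> simp [d, pad, hi, sq]
      have h2 := pad_dotProduct_pad hmp (fun _ => σ) (fun _ => σ)
      calc ∑ i, d i = pad p (fun _ : Fin (m + m) => σ) ⬝ᵥ pad p (fun _ => σ) :=
            Finset.sum_congr rfl fun i _ => h1 i
        _ = 2 * m * σ ^ 2 := by
            rw [h2]
            simp [dotProduct]
            ring
        _ ≤ _ := hσsum
    · simp only [d]
      split_ifs
      · exact hσmax
      · positivity
    · rw [spikeFactor_mulVec_dotProduct_self hν.le hV (hww s) (hVw _)]
    · rw [spikeFactor_mulVec_dotProduct_self hν.le hV (hww s) (hVw _)]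
      have := mul_nonneg hν.le (dotProduct_self_nonneg' x)
      nlinarith
    · have hs : √ν ^ 2 = ν := Real.sq_sqrt hν.le
      have hfac : ∀ j, spikeFactor ν V j₀ (w s) i j ^ 2 =
          ν * (V i j + w s i * (Pi.single j₀ 1 : Fin r → ℝ) j) ^ 2 := fun j => by
        simp only [spikeFactor, Matrix.smul_apply, Matrix.add_apply, Matrix.vecMulVec_apply,
          smul_eq_mul, mul_pow, hs]
      simp only [hfac]
      rw [← Finset.mul_sum]
      gcongr
      by_cases hi : (i : ℕ) < m + m
      · have h1 := spikeVec_sq_le (p := p) hcI.le (by rw [hβ]; linarith [sq_nonneg δ])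
          (hδm'.trans hmcI) s i (β := β)
        simpa [hVi i hi, mul_pow, Pi.single_apply] using h1
      · have h0 : w s i = 0 := pad_of_le _ (not_lt.1 hi)
        simp only [h0, zero_mul, add_zero]
        exact (Finset.sum_le_sum fun j _ => hVle i j).trans ((blockCols_row_sq_le i).trans hbcI)
  choose θ hθ hcov hfac using hex
  choose M hM using fun s => (hfac s).1
  choose N hN using fun s => (hfac s).2
  refine assouad hm0 θ hθ hδ (fun s s' => ?_) (fun s k B hB => ?_)
  · refine le_trans ?_ (sinTheta_spikeFactor hν hV (hww s) (hww s') (hVw _) (hVw _)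
      (hθ s').U_orth (hM s) (hN s'))
    simp only [w]
    rw [spikeVec_dotProduct hmp, signVec_dotProduct, hmβ]
    set H : ℝ := ((Finset.univ.filter fun k => s k ≠ s' k).card : ℝ)
    have hH : H ≤ m := Nat.cast_le.2 ((Finset.card_le_univ _).trans (by simp))
    have hH0 : 0 ≤ δ ^ 2 * H := mul_nonneg (sq_nonneg _) (Nat.cast_nonneg _)
    -- Here `ρ = 1 - 2δ²H`, so `1 - ρ² = 4δ²H(1 - δ²H)`, which is at least `2δ²H`.
    have hH1 : δ ^ 2 * H ≤ 1 / 2 := by nlinarith [sq_nonneg δ]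
    nlinarith
  · rw [hcov, hcov]
    have hi : ((Fin.castLE hmp (Fin.natAdd m k) : Fin p) : ℕ) < m + m := by simp
    have e1 : w s = spikeVec p β (Function.update (signVec δ s) k 0) +
        signVec δ s k • Pi.single (Fin.castLE hmp (Fin.natAdd m k)) 1 := by
      rw [← spikeVec_update hmp, Function.update_eq_self]
    have e2 : w (flip k s) = spikeVec p β (Function.update (signVec δ s) k 0) +
        (-signVec δ s k) • Pi.single (Fin.castLE hmp (Fin.natAdd m k)) 1 := by
      rw [← spikeVec_update hmp, ← signVec_flip]
    rw [e1, e2]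
    refine two_point_spikeFactor (σ := σ)
      (w₀ := spikeVec p β (Function.update (signVec δ s) k 0)) hν hσ hVj ?_ (hVw _) hd0 (fun i => ?_) ?_ ?_ ?_ hB
    · rw [spikeVec_dotProduct hmp, hmβ]
      have := update_dotProduct_self_le (signVec δ s) k
      rw [signVec_dotProduct_self] at this
      linarith
    · by_cases h : (i : ℕ) < m + m
      · simp [d, h]
      · rw [spikeVec, pad_of_le _ (not_lt.1 h), mul_zero, mul_zero]
    · rw [spikeVec_natAdd, Function.update_self]
    · simp only [d, hi, if_true]
    · rwa [signVec_sq]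

end SpikeLowerBound

/-! ### Choice of the parameters and the resulting rates -/

section Rates

/-- The two alternatives match the two cases of the minimum that defines `δ²`: the statistical
limit, or the cap that yields a constant risk. -/
theorem mul_min_le_sqrt {c t X : ℝ} (ht : 0 ≤ t) (h1 : c ^ 2 * t ^ 2 ≤ X ∨ c ^ 2 ≤ X) :
    c * min t 1 ≤ √X := by
  refine Real.le_sqrt_of_sq_le ?_
  have hm : 0 ≤ min t 1 := le_min ht zero_le_one
  rw [mul_pow]
  rcases h1 with h | h
  · refine le_trans ?_ h
    gcongr
    exact min_le_left _ _
  · refine le_trans (mul_le_of_le_one_right (sq_nonneg c) ?_) h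
    exact pow_le_one₀ hm (min_le_right _ _)

variable {p n r b : ℕ} {cI κ σsum σmax ν : ℝ}

theorem lower_bound_row_rate (hn : 1 ≤ n) (hr : 1 ≤ r) (hcI : 0 < cI)
    (hκ : 1 < κ) (hν : 0 < ν) (hσ : 0 < σmax) (hσσ : σmax ≤ σsum) (hb : 0 < b)
    (hbcI : (b : ℝ)⁻¹ ≤ cI) (hp : 4 * b * r ≤ p) :
    ENNReal.ofReal (3 / 32 * (√(min (κ - 1) (min 1 cI)) / 2 *
      min (1 / √n * (√r * σmax / √ν)) 1)) ≤ minimaxRisk cI κ p n r σsum σmax ν := by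
  set K := min (κ - 1) (min 1 cI)
  have hK : 0 < K := lt_min (by linarith) (lt_min one_pos hcI)
  have hK1 : K ≤ 1 := (min_le_right _ _).trans (min_le_left _ _)
  have hrR : (0 : ℝ) < r := by exact_mod_cast hr
  have hnR : (0 : ℝ) < n := by exact_mod_cast hn
  -- The largest `δ²` allowed by the test and by the constraint `rδ² ≤ K`.
  let z : ℝ := min (σmax ^ 2 / (4 * n * ν)) (K / r)
  have hz : 0 ≤ z := le_min (by positivity) (by positivity)
  have hz2 : √z ^ 2 = z := Real.sq_sqrt hz
  have hrz : r * z ≤ K := by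
    calc r * z ≤ r * (K / r) := by gcongr; exact min_le_right _ _
      _ = K := mul_div_cancel₀ _ hrR.ne'
  have hp' : 1 + r * b ≤ p := by nlinarith [Nat.mul_le_mul hr hb]
  have key := lower_bound_noisyRow (p := p) (n := n) (δ := √z) hr hcI hκ hν hσ hσσ hb hbcI hp'
    (Real.sqrt_nonneg z)
    (by rw [hz2]; exact hrz.trans (min_le_left _ _))
    (by rw [hz2]; exact hrz.trans hK1)
    (by rw [hz2]; exact hrz.trans ((min_le_right _ _).trans (min_le_right _ _)))
    (by
      rw [hz2]
      calc n * (ν * z) ≤ n * (ν * (σmax ^ 2 / (4 * n * ν))) := by gcongr; exact min_le_left _ _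
        _ = σmax ^ 2 / 4 := by field_simp)
  refine le_trans (ENNReal.ofReal_le_ofReal ?_) key
  rw [← Real.sqrt_mul hrR.le]
  gcongr
  refine mul_min_le_sqrt (by positivity) ?_
  have hc2 : (√K / 2) ^ 2 = K / 4 := by rw [div_pow, Real.sq_sqrt hK.le]; norm_num
  have ht2 : (1 / √n * (√r * σmax / √ν)) ^ 2 = r * σmax ^ 2 / (n * ν) := by
    rw [mul_pow, div_pow, div_pow, mul_pow, Real.sq_sqrt hnR.le, Real.sq_sqrt hrR.le,
      Real.sq_sqrt hν.le]
    field_simp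
  rw [hc2, ht2]
  rcases min_choice (σmax ^ 2 / (4 * n * ν)) (K / r) with h | h
  · left
    simp only [z, h]
    calc K / 4 * (r * σmax ^ 2 / (n * ν)) ≤ 1 / 4 * (r * σmax ^ 2 / (n * ν)) := by gcongr
      _ = r * (σmax ^ 2 / (4 * n * ν)) := by field_simp
  · right
    simp only [z, h]
    rw [mul_div_cancel₀ _ hrR.ne']
    linarith

theorem lower_bound_spike_rate (hn : 1 ≤ n) (hr : 1 ≤ r) (hcI : 0 < cI)
    (hκ : 1 < κ) (hν : 0 < ν) (hσ : 0 < σmax) (hσσ : σmax ≤ σsum) (hσp : σsum ≤ √p * σmax)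
    (hb : 0 < b) (hbcI : (b : ℝ)⁻¹ ≤ cI) (hp : 4 * b * r ≤ p) :
    ENNReal.ofReal (3 / 32 * (1 / (32 * b) *
      min (1 / √n * (σsum / √ν + σsum * σmax / ν) / 2) 1)) ≤
        minimaxRisk cI κ p n r σsum σmax ν := by
  have hnR : (0 : ℝ) < n := by exact_mod_cast hn
  have hb1 : (1 : ℝ) ≤ b := by exact_mod_cast hb
  have hbR : (0 : ℝ) < b := by linarith
  have hσs : 0 < σsum := hσ.trans_le hσσ
  set k : ℝ := σsum ^ 2 / σmax ^ 2
  have hk : k * σmax ^ 2 = σsum ^ 2 := div_mul_cancel₀ _ (by positivity)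
  have hk1 : 1 ≤ k := by
    rw [one_le_div (by positivity)]
    gcongr
  have hkp : k ≤ p := by
    rw [div_le_iff₀ (by positivity)]
    calc σsum ^ 2 ≤ (√p * σmax) ^ 2 := by gcongr
      _ = p * σmax ^ 2 := by rw [mul_pow, Real.sq_sqrt (Nat.cast_nonneg p)]
  -- The summand `b` ensures `b ≤ m`, hence incoherence of the spike. Dividing `k ≤ p` by 8 leaves
  -- room for the blocks: `2m + rb ≤ p/4 + 3rb ≤ p`. Up to constants depending on `b`, `m` is `k`.
  let m : ℕ := b + ⌊k / 8⌋₊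
  have hfl : (⌊k / 8⌋₊ : ℝ) ≤ k / 8 := Nat.floor_le (by positivity)
  have hfl' : k / 8 < ⌊k / 8⌋₊ + 1 := Nat.lt_floor_add_one _
  have hmR : (m : ℝ) = b + ⌊k / 8⌋₊ := by simp [m]
  have hm0 : (0 : ℝ) < m := by rw [hmR]; positivity
  have hkm : k ≤ 8 * m := by rw [hmR]; linarith
  have hmk : (m : ℝ) ≤ 2 * b * k := by rw [hmR]; nlinarith
  have hmp : m + m + r * b ≤ p := by
    have h1 : (4 * b * r : ℝ) ≤ p := by exact_mod_cast hp
    have h2 : (b : ℝ) * 1 ≤ b * r := by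
      gcongr
      exact_mod_cast hr
    have : (m + m + r * b : ℝ) ≤ p := by rw [hmR]; linarith
    exact_mod_cast this
  -- Since `m ≤ 2bk`, the factor `1/(4b)` keeps the total noise `2mσ²` within `σsum²`.
  set σ : ℝ := √(σmax ^ 2 / (4 * b))
  have hσ2 : σ ^ 2 = σmax ^ 2 / (4 * b) := Real.sq_sqrt (by positivity)
  have hσ0 : 0 < σ := Real.sqrt_pos.2 (by positivity)
  -- The statistical limit for `δ²`. As `mσ²` is comparable to `σsum²`, the product `m * y` is of
  -- the order of the squared target rate.
  let y : ℝ := σ ^ 2 * (σ ^ 2 + ν) / (4 * n * ν ^ 2)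
  let z : ℝ := min y (1 / (2 * m))
  have hz : 0 ≤ z := le_min (by positivity) (by positivity)
  have hz2 : √z ^ 2 = z := Real.sq_sqrt hz
  have key := lower_bound_spike (p := p) (n := n) (m := m) (σ := σ) (δ := √z) (σmax := σmax)
    (σsum := σsum) hr hcI hκ hν hσ0
    (by rw [hσ2, div_le_iff₀ (by positivity)]; nlinarith [sq_nonneg σmax])
    (by
      rw [hσ2, ← hk, mul_div_assoc', div_le_iff₀ (by positivity)]
      nlinarith [mul_le_mul_of_nonneg_right hmk (sq_nonneg σmax)])
    hb hbcI (Nat.le_add_right _ _) hmp (Real.sqrt_nonneg z)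
    (by
      rw [hz2]
      calc m * z ≤ m * (1 / (2 * m)) := by gcongr; exact min_le_right _ _
        _ = 1 / 2 := by field_simp)
    (by
      rw [hz2]
      calc n * (ν ^ 2 * z) ≤ n * (ν ^ 2 * y) := by gcongr; exact min_le_left _ _
        _ = σ ^ 2 * (σ ^ 2 + ν) / 4 := by simp only [y]; field_simp)
  refine le_trans (ENNReal.ofReal_le_ofReal ?_) key
  rw [← Real.sqrt_mul hm0.le]
  gcongr
  refine mul_min_le_sqrt (by positivity) ?_
  rcases min_choice y (1 / (2 * m)) with h | h
  · left
    simp only [z, h, y]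
    have ht2 : (1 / √n * (σsum / √ν + σsum * σmax / ν) / 2) ^ 2 ≤
        σsum ^ 2 * (σmax ^ 2 + ν) / (n * ν ^ 2) := by
      have e1 : (σsum / √ν) ^ 2 = σsum ^ 2 * ν / ν ^ 2 := by
        rw [div_pow, Real.sq_sqrt hν.le]
        field_simp
      have e2 : (1 / √(n : ℝ)) ^ 2 = 1 / n := by rw [div_pow, Real.sq_sqrt hnR.le, one_pow]
      have e3 : (σsum / √ν + σsum * σmax / ν) ^ 2 ≤
          2 * ((σsum / √ν) ^ 2 + (σsum * σmax / ν) ^ 2) := add_sq_le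
      rw [div_pow, mul_pow, e2]
      have e4 : (0 : ℝ) ≤ (σsum / √ν) ^ 2 + (σsum * σmax / ν) ^ 2 := by positivity
      calc _ ≤ 1 / (n : ℝ) * (2 * ((σsum / √ν) ^ 2 + (σsum * σmax / ν) ^ 2)) / 2 ^ 2 := by gcongr
        _ ≤ 1 / (n : ℝ) * ((σsum / √ν) ^ 2 + (σsum * σmax / ν) ^ 2) := by
          rw [div_le_iff₀ (by norm_num)]
          have : (0 : ℝ) ≤ 1 / n * ((σsum / √ν) ^ 2 + (σsum * σmax / ν) ^ 2) := by positivity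
          linarith
        _ = _ := by
          rw [e1]
          field_simp
          ring
    have hms : σsum ^ 2 / (32 * b) ≤ m * σ ^ 2 := by
      rw [hσ2, ← hk, mul_div_assoc', div_le_div_iff₀ (by positivity) (by positivity)]
      nlinarith [mul_le_mul_of_nonneg_right hkm (show 0 ≤ σmax ^ 2 * (4 * b) by positivity)]
    have hsn : (σmax ^ 2 + ν) / (4 * b) ≤ σ ^ 2 + ν := by
      rw [hσ2, add_div]
      gcongr
      exact div_le_self hν.le (by linarith)
    calc (1 / (32 * b : ℝ)) ^ 2 * (1 / √n * (σsum / √ν + σsum * σmax / ν) / 2) ^ 2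
        ≤ (1 / (32 * b : ℝ)) ^ 2 * (σsum ^ 2 * (σmax ^ 2 + ν) / (n * ν ^ 2)) := by gcongr
      _ ≤ 2 * (1 / (32 * b : ℝ)) ^ 2 * (σsum ^ 2 * (σmax ^ 2 + ν) / (n * ν ^ 2)) := by
        have : 0 ≤ (1 / (32 * b : ℝ)) ^ 2 * (σsum ^ 2 * (σmax ^ 2 + ν) / (n * ν ^ 2)) := by
          positivity
        linarith
      _ = σsum ^ 2 / (32 * b) * ((σmax ^ 2 + ν) / (4 * b)) / (4 * n * ν ^ 2) := by
        field_simp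
        norm_num
      _ ≤ m * σ ^ 2 * (σ ^ 2 + ν) / (4 * n * ν ^ 2) := by gcongr
      _ = _ := by ring
  · right
    simp only [z, h]
    have : (m : ℝ) * (1 / (2 * m)) = 1 / 2 := by field_simp
    rw [this, div_pow, div_le_div_iff₀ (by positivity) (by norm_num)]
    nlinarith

end Rates

end HeteroPCA

theorem mainTheorem3 (cI : ℝ) (hcI : 0 < cI) :
    ∃ C : ℝ, 0 < C ∧ ∀ κ : ℝ, 1 < κ → ∃ c : ℝ, 0 < c ∧
      ∀ (p n r : ℕ), 1 ≤ n → 1 ≤ r → C * r ≤ p →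
      ∀ (σsum σmax ν : ℝ), 0 < σmax → σmax ≤ σsum → σsum ≤ √p * σmax → 0 < ν →
        ENNReal.ofReal (c * min
          (1 / √n * ((σsum + √r * σmax) / √ν + σsum * σmax / ν)) 1) ≤
        HeteroPCA.minimaxRisk cI κ p n r σsum σmax ν := by
  set b : ℕ := ⌈cI⁻¹⌉₊
  have hb : 0 < b := Nat.ceil_pos.2 (inv_pos.2 hcI)
  have hbR : (0 : ℝ) < b := by exact_mod_cast hb
  have hbcI : (b : ℝ)⁻¹ ≤ cI := inv_le_of_inv_le₀ hcI (Nat.le_ceil _)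
  -- `C = 4b` is fixed before `κ`; `κ` enters only through `K`.
  refine ⟨4 * b, by positivity, fun κ hκ => ?_⟩
  set K := √(min (κ - 1) (min 1 cI)) / 2
  have hK : 0 < K := half_pos (Real.sqrt_pos.2 (lt_min (by linarith) (lt_min one_pos hcI)))
  set c₀ := min (1 / (32 * (b : ℝ))) K
  have hc₀ : 0 < c₀ := lt_min (by positivity) hK
  refine ⟨3 / 32 * (c₀ / 3), by positivity, ?_⟩
  intro p n r hn hr hp σsum σmax ν hσ hσσ hσp hν
  have hp' : 4 * b * r ≤ p := by exact_mod_cast hp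
  have hσs : 0 < σsum := hσ.trans_le hσσ
  have hrow := HeteroPCA.lower_bound_row_rate (p := p) hn hr hcI hκ hν hσ hσσ hb hbcI hp'
  have hspike := HeteroPCA.lower_bound_spike_rate hn hr hcI hκ hν hσ hσσ hσp hb hbcI hp'
  set x := 1 / √n * (√r * σmax / √ν)
  set y := 1 / √n * (σsum / √ν + σsum * σmax / ν) / 2
  have hx : 0 ≤ x := by positivity
  have hy : 0 ≤ y := by positivity
  have hxy : 1 / √n * ((σsum + √r * σmax) / √ν + σsum * σmax / ν) = x + 2 * y := by
    simp only [x, y]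
    ring
  -- The target is `x + 2y`, so the larger of `x` and `y` is at least a third of it; this is the `3`
  -- in the constant.
  have hmin : ∀ t, 0 ≤ t → x + 2 * y ≤ 3 * t → min (x + 2 * y) 1 ≤ 3 * min t 1 := by
    intro t ht h
    rcases le_total t 1 with h1 | h1
    · rw [min_eq_left h1]
      exact (min_le_left _ _).trans h
    · rw [min_eq_right h1]
      exact (min_le_right _ _).trans (by norm_num)
  rw [hxy]
  rcases le_total x y with h | h
  · refine le_trans (ENNReal.ofReal_le_ofReal ?_) hspike
    have h1 := hmin y hy (by linarith)
    have h2 : 0 ≤ min y 1 := le_min hy zero_le_one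
    calc 3 / 32 * (c₀ / 3) * min (x + 2 * y) 1 ≤ 3 / 32 * (c₀ / 3) * (3 * min y 1) := by gcongr
      _ = 3 / 32 * (c₀ * min y 1) := by ring
      _ ≤ _ := by gcongr; exact min_le_left _ _
  · refine le_trans (ENNReal.ofReal_le_ofReal ?_) hrow
    have h1 := hmin x hx (by linarith)
    have h2 : 0 ≤ min x 1 := le_min hx zero_le_one
    calc 3 / 32 * (c₀ / 3) * min (x + 2 * y) 1 ≤ 3 / 32 * (c₀ / 3) * (3 * min x 1) := by gcongr
      _ = 3 / 32 * (c₀ * min x 1) := by ring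
      _ ≤ _ := by gcongr; exact min_le_right _ _
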